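/- Let $\mathcal K$ be a (strict) 2-category; composition is written by juxtaposition, and $\cdot$ is vertical composition of 2-cells. **Setting.** For 1-cells $F\colon X\to Z$, $G\colon Y\to Z$, $F'\colon X\to Z'$, $G'\colon Y\to Z'$, an *operator* $(-)^\#\colon[F,G]\to[F',G']$ is a family of functions $\mathcal K[O,Z](FA,GB)\to\mathcal K[O,Z'](F'A,G'B)$, for all spans $A\colon O\to X$, $B\colon O\to Y$, such that $(fP)^\#=f^\#P$ for $P\colon O'\to O$, $(f\cdot F\alpha)^\#=f^\#\cdot F'\alpha$ for $\alpha\colon A'\to A$, and $(G\beta\cdot f)^\#=G'\beta\cdot f^\#$ for $\beta\colon B\to B'$. A *relative monad* $(X,I,T)$ consists of 1-cells $I,T\colon X_0\to X$, a 2-cell $t\colon I\to T$ and an operator $(-)^\dagger\colon[I,T]\to[T,T]$ with $k^\dagger\cdot tA=k$, $t^\dagger=1_T$ and $(l^\dagger\cdot k)^\dagger=l^\dagger\cdot k^\dagger$ for $k\colon IA\to TB$, $l\colon IB\to TC$. A *monad $(S,S_0)$ compatible with $I$* consists of monads $(S,m,s)$ on $X$ and $(S_0,m_0,s_0)$ on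 $X_0$ with $SI=IS_0$, $mI=Im_0$, $sI=Is_0$. Fix a relative monad $(X,I,T)$ in $\mathcal K$ and a monad $(S,S_0)$ compatible with $I$. **(i) Relative distributive laws.** A *relative distributive law* of $T$ over $(S,S_0)$ is a 2-cell $d\colon ST\to TS_0$ such that $d\cdot mT=Tm_0\cdot dS_0\cdot Sd$, $d\cdot sT=Ts_0$, $dB\cdot S(f^\dagger)=(dB\cdot Sf)^\dagger\cdot dA$ for all $f\colon IA\to TB$, and $d\cdot St=tS_0$. **(ii) Liftings to algebras.** For a monad $S$ on $X$ let $S\text{-}\mathrm{Alg}(-)\colon\mathcal K^{op}\to\mathbf{Cat}$ send $K$ to the category of $S$-algebras $(M\colon K\to X,\ SM\to M)$. Let $U\colon S\text{-}\mathrm{Alg}(-)\to\mathcal K(-,X)$ and $U_0\colon S_0\text{-}\mathrm{Alg}(-)\to\mathcal K(-,X_0)$ be the forgetful 2-natural transformations, and $I_*\colon S_0\text{-}\mathrm{Alg}(-)\to S\text{-}\mathrm{Alg}(-)$, $(M,m)\mapsto(IM,Im)$. A *lifting of $T$ to the algebras of $(S,S_0)$* is a relative monad $(I_*,\hat T)$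 in the 2-category $[\mathcal K^{op},\mathbf{Cat}]$ of 2-functors, 2-natural transformations and modifications, with $U\hat T=(T\circ-)U_0$, and such that on underlying 2-cells its extension operator is $f\mapsto f^\dagger$ and its unit at $(M,m)$ is $tM$. **(iii) Liftings to relative right modules.** A *$K$-indexed relative right $T$-module* is a 1-cell $M\colon X_0\to K$ with an operator $(-)_m\colon[I,T]\to[M,M]$ such that $t_m=1_M$ and $(k^\dagger\cdot h)_m=k_m\cdot h_m$; a morphism $(M,(-)_m)\to(N,(-)_n)$ is a 2-cell $f\colon M\to N$ with $fB\cdot h_m=h_n\cdot fA$ for all $h\colon IA\to TB$. These form a 2-functor $\mathrm{Mod}_T(-)\colon\mathcal K\to\mathbf{Cat}$. Let $J_0^*\colon\mathrm{Mod}_T(-)\to\mathcal K(X_0,-)$, $(M,(-)_m)\mapsto M$, and $U^*\colon\mathcal K(X,-)\to\mathrm{Mod}_T(-)$, $N\mapsto(NT,N(-)^\dagger)$; whiskering $t$ gives a modification $t\colon -\circ I\to J_0^*U^*$. For a 2-category $\mathcal B$, a 1-cell $(F,\varphi)\colon(a,P)\to(b,Q)$ of $\mathbf{Mnd}(\mathcal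 B^{op})^{op}$ is a 1-cell $F\colon a\to b$ with a 2-cell $\varphi\colon FP\to QF$ compatible with units and multiplications; a 2-cell $(F,\varphi)\to(F',\varphi')$ is a 2-cell $p\colon F\to F'$ with $\varphi'\cdot pP=Qp\cdot\varphi$. A *lifting of $S$ to the relative right modules of $T$* is a monad $\tilde S$ on $\mathrm{Mod}_T(-)$ in $[\mathcal K,\mathbf{Cat}]$ together with a modification $d^*\colon U^*(-\circ S)\to\tilde SU^*$ such that 1. the monads $-\circ S_0$ on $\mathcal K(X_0,-)$ and $\tilde S$ on $\mathrm{Mod}_T(-)$ are compatible with $J_0^*$: $J_0^*\tilde S=(-\circ S_0)J_0^*$, and likewise for multiplications and units; 2. $(U^*,d^*)\colon(\mathcal K(X,-),-\circ S)\to(\mathrm{Mod}_T(-),\tilde S)$ is a 1-cell of $\mathbf{Mnd}([\mathcal K,\mathbf{Cat}]^{op})^{op}$; 3. $t\colon(-\circ I,1)\to(J_0^*,1)(U^*,d^*)$ is a 2-cell of $\mathbf{Mnd}([\mathcal K,\mathbf{Cat}]^{op})^{op}$; 4. for every $f\colon IA\to TB$ and every module $(M,(-)_m)$, $f_{\tilde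 Sm}=(f_{\tilde ST}\cdot tS_0A)_m$, where $(-)_{\tilde Sm}$ and $(-)_{\tilde ST}$ are the operators of $\tilde S(M,(-)_m)$ and $\tilde S(T,(-)^\dagger)$. **Theorem.** Relative distributive laws of $T$ over $(S,S_0)$, liftings of $T$ to the algebras of $(S,S_0)$, and liftings of $S$ to the relative right modules of $T$ are equivalent data. Precisely: - (i)$\Leftrightarrow$(ii): there is a bijection between relative distributive laws and liftings of $T$ to the algebras. It sends $d$ to the lifting $\hat T$ for which $\hat T(M,m)$ has structure map $STM\xrightarrow{dM}TS_0M\xrightarrow{Tm}TM$; its inverse sends $\hat T$ to $ST\xrightarrow{STs_0}STS_0\to TS_0$, the second map being the structure map of $\hat T(S_0,m_0)$. - (i)$\Leftrightarrow$(iii): there is a bijection between relative distributive laws and liftings of $S$ to the relative right modules. It sends $d$ to the lifting with $\tilde S(M,(-)_m)=(MS_0,\ f\mapsto(dB\cdot Sf)_m)$ for $f\colon IA\to TB$, and $d^*_N=Nd$ for $N\colon X\to K$; its inverse sends $(\tilde S,d^*)$ to the component of $J_0^*d^*$ at $1_X$. -/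

import Mathlib

open CategoryTheory Bicategory Opposite

universe r w v u w₁ w₂ v₁ v₂ u₁ u₂

namespace RelBeck

section FunctorTwoCategory

variable {C : Type u₁} [Bicategory.{w₁, v₁} C] {D : Type u₂} [Bicategory.{w₂, v₂} D]

/-- A (strict) 2-natural transformation between 2-functors. -/
@[ext]
structure TwoNatTrans (F G : StrictPseudofunctor C D) where
  app (a : C) : F.obj a ⟶ G.obj a
  naturality {a b : C} (f : a ⟶ b) : F.map f ≫ app b = app a ≫ G.map f
  naturality₂ {a b : C} {f g : a ⟶ b} (β : f ⟶ g) :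
    F.map₂ β ▷ app b ≫ eqToHom (naturality g) = eqToHom (naturality f) ≫ app a ◁ G.map₂ β

/-- A modification between 2-natural transformations. -/
@[ext]
structure TwoMod {F G : StrictPseudofunctor C D} (η θ : TwoNatTrans F G) where
  app (a : C) : η.app a ⟶ θ.app a
  naturality {a b : C} (f : a ⟶ b) :
    F.map f ◁ app b ≫ eqToHom (θ.naturality f) = eqToHom (η.naturality f) ≫ app a ▷ G.map f


namespace TwoNatTrans

/-- The identity 2-natural transformation. -/
@[simps]
abbrev id [Strict D] (F : StrictPseudofunctor C D) : TwoNatTrans F F where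
  app a := 𝟙 (F.obj a)
  naturality f := by rw [Strict.comp_id, Strict.id_comp]
  naturality₂ β := by
    simp [Strict.leftUnitor_eqToIso, Strict.rightUnitor_eqToIso]

/-- Composition of 2-natural transformations. -/
@[simps]
abbrev comp [Strict D] {F G H : StrictPseudofunctor C D} (η : TwoNatTrans F G) (θ : TwoNatTrans G H) :
    TwoNatTrans F H where
  app a := η.app a ≫ θ.app a
  naturality f := by
    rw [← Strict.assoc, η.naturality, Strict.assoc, θ.naturality, Strict.assoc]
  naturality₂ {a b f g} β := by
    have h1 := congrArg (· ▷ θ.app b) (η.naturality₂ β)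
    have h2 := congrArg (η.app a ◁ ·) (θ.naturality₂ β)
    simp only [comp_whiskerRight, whiskerLeft_comp, eqToHom_whiskerRight, whiskerLeft_eqToHom,
      whisker_assoc, Strict.associator_eqToIso, eqToIso.hom, eqToIso.inv] at h1 h2
    rw [comp_eqToHom_iff] at h1 h2
    simp only [whiskerRight_comp, comp_whiskerLeft, Strict.associator_eqToIso, eqToIso.hom,
      eqToIso.inv, h1, Category.assoc, eqToHom_trans, eqToHom_trans_assoc]
    simp [h2]

instance (F G : StrictPseudofunctor C D) : Category (TwoNatTrans F G) where
  Hom η θ := TwoMod η θ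
  id η := { app := fun a => 𝟙 (η.app a), naturality := by simp }
  comp Γ Γ' :=
    { app := fun a => Γ.app a ≫ Γ'.app a
      naturality := fun f => by
        rw [whiskerLeft_comp, Category.assoc, Γ'.naturality, ← Category.assoc, Γ.naturality,
          Category.assoc, comp_whiskerRight] }

@[ext]
theorem hom_ext {F G : StrictPseudofunctor C D} {η θ : TwoNatTrans F G} {Γ Γ' : η ⟶ θ}
    (h : ∀ a, TwoMod.app Γ a = TwoMod.app Γ' a) : Γ = Γ' :=
  TwoMod.ext (funext h)

@[simp]
theorem id_mod_app {F G : StrictPseudofunctor C D} (η : TwoNatTrans F G) (a : C) :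
    TwoMod.app (𝟙 η) a = 𝟙 (η.app a) := rfl

@[simp]
theorem comp_mod_app {F G : StrictPseudofunctor C D} {η θ κ : TwoNatTrans F G} (Γ : η ⟶ θ)
    (Γ' : θ ⟶ κ) (a : C) : TwoMod.app (Γ ≫ Γ') a = TwoMod.app Γ a ≫ TwoMod.app Γ' a := rfl

@[simp]
theorem eqToHom_mod_app {F G : StrictPseudofunctor C D} {η θ : TwoNatTrans F G} (h : η = θ)
    (a : C) : TwoMod.app (eqToHom h) a = eqToHom (by rw [h]) := by
  subst h; rfl

/-- An invertible modification with invertible components. -/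
@[simps]
def isoMk {F G : StrictPseudofunctor C D} {η θ : TwoNatTrans F G}
    (e : ∀ a, η.app a ≅ θ.app a)
    (nat : ∀ {a b : C} (f : a ⟶ b), F.map f ◁ (e b).hom ≫ eqToHom (θ.naturality f) =
      eqToHom (η.naturality f) ≫ (e a).hom ▷ G.map f) : η ≅ θ where
  hom := { app := fun a => (e a).hom, naturality := nat }
  inv :=
    { app := fun a => (e a).inv
      naturality := fun {a b} f => by
        have h := nat f
        rw [← cancel_epi (F.map f ◁ (e b).hom), ← whiskerLeft_comp_assoc, Iso.hom_inv_id,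
          whiskerLeft_id, Category.id_comp, ← Category.assoc, h, Category.assoc,
          ← comp_whiskerRight, Iso.hom_inv_id, id_whiskerRight, Category.comp_id] }
  hom_inv_id := by ext a; simp
  inv_hom_id := by ext a; simp

theorem strict_whiskerLeft_whiskerLeft [Strict D] {a b c d : D} (f : a ⟶ b) (g : b ⟶ c)
    {h h' : c ⟶ d} (β : h ⟶ h') : f ◁ g ◁ β =
      eqToHom (Strict.assoc f g h).symm ≫ (f ≫ g) ◁ β ≫ eqToHom (Strict.assoc f g h') := by
  simp [Strict.associator_eqToIso]

theorem strict_whiskerRight_whiskerRight [Strict D] {a b c d : D} {f f' : a ⟶ b}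
    (β : f ⟶ f') (g : b ⟶ c) (h : c ⟶ d) : β ▷ g ▷ h =
      eqToHom (Strict.assoc f g h) ≫ β ▷ (g ≫ h) ≫ eqToHom (Strict.assoc f' g h).symm := by
  simp [Strict.associator_eqToIso]

theorem strict_whisker_assoc [Strict D] {a b c d : D} (f : a ⟶ b) {g g' : b ⟶ c}
    (β : g ⟶ g') (h : c ⟶ d) : f ◁ β ▷ h =
      eqToHom (Strict.assoc f g h).symm ≫ (f ◁ β) ▷ h ≫ eqToHom (Strict.assoc f g' h) := by
  simp [Strict.associator_eqToIso]

/-- Left whiskering of a modification. -/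
@[simps]
def whiskerL [Strict D] {F G H : StrictPseudofunctor C D} (η : TwoNatTrans F G)
    {θ κ : TwoNatTrans G H} (Γ : TwoMod θ κ) : TwoMod (comp η θ) (comp η κ) where
  app a := η.app a ◁ Γ.app a
  naturality {a b} f := by
    have h := congrArg (η.app a ◁ ·) (Γ.naturality f)
    simp only [whiskerLeft_comp, whiskerLeft_eqToHom] at h
    rw [comp_eqToHom_iff] at h
    dsimp only
    rw [strict_whiskerLeft_whiskerLeft, congr_whiskerLeft (η.naturality f),
      comp_whiskerLeft, h]
    simp [Strict.associator_eqToIso]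

/-- Right whiskering of a modification. -/
@[simps]
def whiskerR [Strict D] {F G H : StrictPseudofunctor C D} {η θ : TwoNatTrans F G}
    (Γ : TwoMod η θ) (κ : TwoNatTrans G H) : TwoMod (comp η κ) (comp θ κ) where
  app a := Γ.app a ▷ κ.app a
  naturality {a b} f := by
    have h := congrArg (· ▷ κ.app b) (Γ.naturality f)
    simp only [comp_whiskerRight, eqToHom_whiskerRight] at h
    rw [comp_eqToHom_iff] at h
    dsimp only
    rw [strict_whiskerRight_whiskerRight, whiskerRight_congr (κ.naturality f).symm,
      whiskerRight_comp, strict_whisker_assoc, h]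
    simp [Strict.associator_eqToIso]

/-- The associator. -/
def assoc [Strict D] {F G H J : StrictPseudofunctor C D} (η : TwoNatTrans F G)
    (θ : TwoNatTrans G H) (κ : TwoNatTrans H J) :
    comp (comp η θ) κ ≅ comp η (comp θ κ) :=
  isoMk (fun a => α_ (η.app a) (θ.app a) (κ.app a)) (fun f => by
    dsimp only
    simp [Strict.associator_eqToIso])

/-- The left unitor. -/
def leftUnitor [Strict D] {F G : StrictPseudofunctor C D} (η : TwoNatTrans F G) :
    comp (id F) η ≅ η :=
  isoMk (fun a => λ_ (η.app a)) (fun f => by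
    dsimp only
    simp [Strict.leftUnitor_eqToIso])

/-- The right unitor. -/
def rightUnitor [Strict D] {F G : StrictPseudofunctor C D} (η : TwoNatTrans F G) :
    comp η (id G) ≅ η :=
  isoMk (fun a => ρ_ (η.app a)) (fun f => by
    dsimp only
    simp [Strict.rightUnitor_eqToIso])

end TwoNatTrans

variable [Strict D]

instance : Bicategory.{max u₁ w₂, max u₁ v₂} (StrictPseudofunctor C D) where
  Hom F G := TwoNatTrans F G
  id F := TwoNatTrans.id F
  comp η θ := TwoNatTrans.comp η θ
  homCategory F G := inferInstanceAs (Category (TwoNatTrans F G))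
  whiskerLeft η _ _ Γ := TwoNatTrans.whiskerL η Γ
  whiskerRight Γ κ := TwoNatTrans.whiskerR Γ κ
  associator η θ κ := TwoNatTrans.assoc η θ κ
  leftUnitor η := TwoNatTrans.leftUnitor η
  rightUnitor η := TwoNatTrans.rightUnitor η
  whiskerLeft_id _ _ := TwoMod.ext (funext fun _ => whiskerLeft_id _ _)
  whiskerLeft_comp _ _ _ _ _ _ := TwoMod.ext (funext fun _ => whiskerLeft_comp _ _ _)
  id_whiskerLeft _ := TwoMod.ext (funext fun _ => id_whiskerLeft _)
  comp_whiskerLeft _ _ _ _ _ := TwoMod.ext (funext fun _ => comp_whiskerLeft _ _ _)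
  id_whiskerRight _ _ := TwoMod.ext (funext fun _ => id_whiskerRight _ _)
  comp_whiskerRight _ _ _ := TwoMod.ext (funext fun _ => comp_whiskerRight _ _ _)
  whiskerRight_id _ := TwoMod.ext (funext fun _ => whiskerRight_id _)
  whiskerRight_comp _ _ _ := TwoMod.ext (funext fun _ => whiskerRight_comp _ _ _)
  whisker_assoc _ _ _ _ _ := TwoMod.ext (funext fun _ => whisker_assoc _ _ _)
  whisker_exchange _ _ := TwoMod.ext (funext fun _ => whisker_exchange _ _)
  pentagon _ _ _ _ := TwoMod.ext (funext fun _ => pentagon _ _ _ _)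
  triangle _ _ := TwoMod.ext (funext fun _ => triangle _ _)

instance : Strict (StrictPseudofunctor C D) where
  id_comp η := TwoNatTrans.ext (funext fun a => Strict.id_comp (TwoNatTrans.app η a))
  comp_id η := TwoNatTrans.ext (funext fun a => Strict.comp_id (TwoNatTrans.app η a))
  assoc η θ κ := TwoNatTrans.ext (funext fun a =>
    Strict.assoc (TwoNatTrans.app η a) (TwoNatTrans.app θ a) (TwoNatTrans.app κ a))
  leftUnitor_eqToIso η := by
    refine Iso.ext (TwoMod.ext (funext fun a => ?_))
    rw [eqToIso.hom, TwoNatTrans.eqToHom_mod_app]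
    exact congrArg Iso.hom (Strict.leftUnitor_eqToIso (TwoNatTrans.app η a))
  rightUnitor_eqToIso η := by
    refine Iso.ext (TwoMod.ext (funext fun a => ?_))
    rw [eqToIso.hom, TwoNatTrans.eqToHom_mod_app]
    exact congrArg Iso.hom (Strict.rightUnitor_eqToIso (TwoNatTrans.app η a))
  associator_eqToIso η θ κ := by
    refine Iso.ext (TwoMod.ext (funext fun a => ?_))
    rw [eqToIso.hom, TwoNatTrans.eqToHom_mod_app]
    exact congrArg Iso.hom (Strict.associator_eqToIso (TwoNatTrans.app η a)
      (TwoNatTrans.app θ a) (TwoNatTrans.app κ a))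

end FunctorTwoCategory

section General

variable {B : Type u} [Bicategory.{w, v} B]

/-- A monad on the object `a` of a 2-category. -/
structure Mnd (a : B) where
  S : a ⟶ a
  mul : S ≫ S ⟶ S
  unit : 𝟙 a ⟶ S
  unit_left : unit ▷ S ≫ mul = (λ_ S).hom
  unit_right : S ◁ unit ≫ mul = (ρ_ S).hom
  assoc : mul ▷ S ≫ mul = (α_ S S S).hom ≫ S ◁ mul ≫ mul

/-- `(F, φ)` with `φ : F S ⟶ T F` is a 1-cell `(a, S) ⟶ (b, T)` of `Mnd(Bᵒᵖ)ᵒᵖ`. -/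
structure IsMndMor {a b : B} (S : Mnd a) (T : Mnd b) (F : a ⟶ b)
    (φ : S.S ≫ F ⟶ F ≫ T.S) : Prop where
  unit : S.unit ▷ F ≫ φ = (λ_ F).hom ≫ (ρ_ F).inv ≫ F ◁ T.unit
  mul : S.mul ▷ F ≫ φ = (α_ S.S S.S F).hom ≫ S.S ◁ φ ≫ (α_ S.S F T.S).inv ≫ φ ▷ T.S ≫
    (α_ F T.S T.S).hom ≫ F ◁ T.mul

/-- `p : F ⟶ F'` is a 2-cell `(F, φ) ⟶ (F', φ')` of `Mnd(Bᵒᵖ)ᵒᵖ`. -/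
def IsMndTrans {a b : B} (S : Mnd a) (T : Mnd b) {F F' : a ⟶ b}
    (φ : S.S ≫ F ⟶ F ≫ T.S) (φ' : S.S ≫ F' ⟶ F' ≫ T.S) (p : F ⟶ F') : Prop :=
  S.S ◁ p ≫ φ' = φ ≫ p ▷ T.S

/-- The 2-cell of the composite of `(F, φ) : (a, S) ⟶ (b, T)` and `(G, γ) : (b, T) ⟶ (c, R)`. -/
def mndMorComp {a b c : B} {S : Mnd a} {T : Mnd b} {R : Mnd c} {F : a ⟶ b} {G : b ⟶ c}
    (φ : S.S ≫ F ⟶ F ≫ T.S) (γ : T.S ≫ G ⟶ G ≫ R.S) :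
    S.S ≫ (F ≫ G) ⟶ (F ≫ G) ≫ R.S :=
  (α_ S.S F G).inv ≫ φ ▷ G ≫ (α_ F T.S G).hom ≫ F ◁ γ ≫ (α_ F G R.S).inv

/-- The pair of monads `(S, S₀)` is compatible with `I : a₀ ⟶ a`: `S I = I S₀`, `m I = I m₀` and
`s I = I s₀`. -/
structure Compatible {a₀ a : B} (I : a₀ ⟶ a) (S₀ : Mnd a₀) (S : Mnd a) : Prop where
  comm : I ≫ S.S = S₀.S ≫ I
  mul : I ◁ S.mul ≫ eqToHom comm = (α_ I S.S S.S).inv ≫ eqToHom comm ▷ S.S ≫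
    (α_ S₀.S I S.S).hom ≫ S₀.S ◁ eqToHom comm ≫ (α_ S₀.S S₀.S I).inv ≫ S₀.mul ▷ I
  unit : I ◁ S.unit ≫ eqToHom comm = (ρ_ I).hom ≫ (λ_ I).inv ≫ S₀.unit ▷ I

/-- An operator `[F, G] ⟶ [F', G']` between cospans `(F, G)` and `(F', G')`. -/
structure Operator {x y z z' : B} (F : x ⟶ z) (G : y ⟶ z) (F' : x ⟶ z') (G' : y ⟶ z') where
  app {o : B} (A : o ⟶ x) (C : o ⟶ y) (f : A ≫ F ⟶ C ≫ G) : A ≫ F' ⟶ C ≫ G'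
  index {o o' : B} (P : o' ⟶ o) (A : o ⟶ x) (C : o ⟶ y) (f : A ≫ F ⟶ C ≫ G) :
    app (P ≫ A) (P ≫ C) ((α_ P A F).hom ≫ P ◁ f ≫ (α_ P C G).inv) =
      (α_ P A F').hom ≫ P ◁ app A C f ≫ (α_ P C G').inv
  left {o : B} {A A' : o ⟶ x} (C : o ⟶ y) (α : A' ⟶ A) (f : A ≫ F ⟶ C ≫ G) :
    app A' C (α ▷ F ≫ f) = α ▷ F' ≫ app A C f
  right {o : B} (A : o ⟶ x) {C C' : o ⟶ y} (f : A ≫ F ⟶ C ≫ G) (β : C ⟶ C') :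
    app A C' (f ≫ β ▷ G) = app A C f ≫ β ▷ G'

/-- A relative monad on the 1-cell `I : a₀ ⟶ a`. -/
structure RelMonad {a₀ a : B} (I : a₀ ⟶ a) where
  T : a₀ ⟶ a
  ext : Operator I T T T
  unit : I ⟶ T
  unit_left {o : B} (A C : o ⟶ a₀) (k : A ≫ I ⟶ C ≫ T) : A ◁ unit ≫ ext.app A C k = k
  unit_right : ext.app (𝟙 a₀) (𝟙 a₀) (𝟙 a₀ ◁ unit) = 𝟙 (𝟙 a₀ ≫ T)
  assoc {o : B} (A C E : o ⟶ a₀) (k : A ≫ I ⟶ C ≫ T) (l : C ≫ I ⟶ E ≫ T) :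
    ext.app A E (k ≫ ext.app C E l) = ext.app A C k ≫ ext.app C E l

variable {a₀ a : B} {I : a₀ ⟶ a}

/-- For `d : S T ⟶ T S₀` and `f : I A ⟶ T C`, the 2-cell `d C · S f : I S₀ A = S I A ⟶ T S₀ C`. -/
def distExt (T : RelMonad I) {S₀ : Mnd a₀} {S : Mnd a} (h : Compatible I S₀ S)
    (d : T.T ≫ S.S ⟶ S₀.S ≫ T.T) {o : B} (A C : o ⟶ a₀) (f : A ≫ I ⟶ C ≫ T.T) :
    (A ≫ S₀.S) ≫ I ⟶ (C ≫ S₀.S) ≫ T.T :=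
  (α_ A S₀.S I).hom ≫ A ◁ eqToHom h.comm.symm ≫ (α_ A I S.S).inv ≫ f ▷ S.S ≫
    (α_ C T.T S.S).hom ≫ C ◁ d ≫ (α_ C S₀.S T.T).inv

/-- A relative distributive law `d : S T ⟶ T S₀` of `T` over `(S, S₀)`. -/
structure RelDistLaw (T : RelMonad I) {S₀ : Mnd a₀} {S : Mnd a} (h : Compatible I S₀ S) where
  d : T.T ≫ S.S ⟶ S₀.S ≫ T.T
  mul : T.T ◁ S.mul ≫ d = (α_ T.T S.S S.S).inv ≫ d ▷ S.S ≫ (α_ S₀.S T.T S.S).hom ≫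
    S₀.S ◁ d ≫ (α_ S₀.S S₀.S T.T).inv ≫ S₀.mul ▷ T.T
  unit : T.T ◁ S.unit ≫ d = (ρ_ T.T).hom ≫ (λ_ T.T).inv ≫ S₀.unit ▷ T.T
  extension {o : B} (A C : o ⟶ a₀) (f : A ≫ I ⟶ C ≫ T.T) :
    (α_ A T.T S.S).hom ≫ A ◁ d ≫ (α_ A S₀.S T.T).inv ≫
        T.ext.app (A ≫ S₀.S) (C ≫ S₀.S) (distExt T h d A C f) =
      T.ext.app A C f ▷ S.S ≫ (α_ C T.T S.S).hom ≫ C ◁ d ≫ (α_ C S₀.S T.T).inv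
  relUnit : T.unit ▷ S.S ≫ d = eqToHom h.comm ≫ S₀.S ◁ T.unit

end General

section Opposite

variable {K : Type u} [Bicategory.{w, v} K]

open Bicategory.Opposite

theorem unop2_eqToHom {a b : Kᵒᵖ} {f g : a ⟶ b} (h : f = g) :
    (eqToHom h).unop2 = eqToHom (congrArg Quiver.Hom.unop h) := by
  subst h; rfl

instance [Strict K] : Strict Kᵒᵖ where
  id_comp f := congrArg Quiver.Hom.op (Strict.comp_id f.unop)
  comp_id f := congrArg Quiver.Hom.op (Strict.id_comp f.unop)
  assoc f g h := congrArg Quiver.Hom.op (Strict.assoc h.unop g.unop f.unop).symm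
  leftUnitor_eqToIso f := by
    ext
    change op2 (ρ_ f.unop).hom = _
    rw [Strict.rightUnitor_eqToIso, eqToIso.hom, eqToIso.hom, ← op2_unop2 (eqToHom _),
      unop2_eqToHom]
  rightUnitor_eqToIso f := by
    ext
    change op2 (λ_ f.unop).hom = _
    rw [Strict.leftUnitor_eqToIso, eqToIso.hom, eqToIso.hom, ← op2_unop2 (eqToHom _),
      unop2_eqToHom]
  associator_eqToIso f g h := by
    ext
    change op2 (α_ h.unop g.unop f.unop).inv = _
    rw [Strict.associator_eqToIso, eqToIso.inv, eqToIso.hom, ← op2_unop2 (eqToHom _),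
      unop2_eqToHom]

end Opposite

section HomCategories

variable {K : Type u} [Bicategory.{w, v} K]

/-- The hom-category `K(a, b)`, with its objects lifted to a larger universe. -/
@[ext]
structure OneCell (a b : K) : Type (max r v) where
  hom : a ⟶ b

/-- A 2-cell, as a morphism of the hom-category. -/
@[ext]
structure TwoCell {a b : K} (f g : OneCell.{r} a b) : Type w where
  hom : f.hom ⟶ g.hom

instance (a b : K) : Category.{w} (OneCell.{r} a b) where
  Hom f g := TwoCell f g
  id f := ⟨𝟙 f.hom⟩
  comp β γ := ⟨β.hom ≫ γ.hom⟩

namespace OneCell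

variable {a b : K}

@[ext]
theorem hom_ext {f g : OneCell.{r} a b} {β γ : f ⟶ g} (h : TwoCell.hom β = TwoCell.hom γ) :
    β = γ :=
  TwoCell.ext h

@[simp]
theorem id_hom (f : OneCell.{r} a b) : TwoCell.hom (𝟙 f) = 𝟙 f.hom := rfl

@[simp]
theorem comp_hom {f g h : OneCell.{r} a b} (β : f ⟶ g) (γ : g ⟶ h) :
    TwoCell.hom (β ≫ γ) = TwoCell.hom β ≫ TwoCell.hom γ := rfl

@[simp]
theorem eqToHom_hom {f g : OneCell.{r} a b} (h : f = g) :
    TwoCell.hom (eqToHom h) = eqToHom (congrArg OneCell.hom h) := by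
  subst h; rfl

end OneCell

/-- Constructor for `Cat`-valued 2-functors. -/
def mkCatFunctor {C : Type u₁} [Bicategory.{w₁, v₁} C] [Strict C]
    (obj : C → Type u₂) [∀ k, Category.{v₂} (obj k)]
    (map : ∀ {k k' : C}, (k ⟶ k') → (obj k ⥤ obj k'))
    (map₂ : ∀ {k k' : C} {P Q : k ⟶ k'}, (P ⟶ Q) → (map P ⟶ map Q))
    (map_id : ∀ k, map (𝟙 k) = 𝟭 (obj k))
    (map_comp : ∀ {k k' k'' : C} (P : k ⟶ k') (Q : k' ⟶ k''), map (P ≫ Q) = map P ⋙ map Q)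
    (map₂_id : ∀ {k k' : C} (P : k ⟶ k') (x : obj k), (map₂ (𝟙 P)).app x = 𝟙 ((map P).obj x))
    (map₂_comp : ∀ {k k' : C} {P Q R : k ⟶ k'} (β : P ⟶ Q) (γ : Q ⟶ R) (x : obj k),
      (map₂ (β ≫ γ)).app x = (map₂ β).app x ≫ (map₂ γ).app x)
    (map₂_left : ∀ {k k' k'' : C} (P : k ⟶ k') {Q Q' : k' ⟶ k''} (β : Q ⟶ Q') (x : obj k),
      (map₂ (P ◁ β)).app x = eqToHom (by rw [map_comp]; rfl) ≫
        (map₂ β).app ((map P).obj x) ≫ eqToHom (by rw [map_comp]; rfl))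
    (map₂_right : ∀ {k k' k'' : C} {P P' : k ⟶ k'} (β : P ⟶ P') (Q : k' ⟶ k'') (x : obj k),
      (map₂ (β ▷ Q)).app x = eqToHom (by rw [map_comp]; rfl) ≫
        (map Q).map ((map₂ β).app x) ≫ eqToHom (by rw [map_comp]; rfl)) :
    StrictPseudofunctor C Cat.{v₂, u₂} :=
  StrictPseudofunctor.mk''
    { obj := fun k => Cat.of (obj k)
      map := fun P => (map P).toCatHom
      map₂ := fun β => (map₂ β).toCatHom₂
      map_id := fun k => Cat.ext (map_id k)
      map_comp := fun P Q => Cat.ext (map_comp P Q)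
      map₂_id := fun P => Cat.Hom₂.ext (NatTrans.ext (funext (map₂_id P)))
      map₂_comp := fun β γ => Cat.Hom₂.ext (NatTrans.ext (funext (map₂_comp β γ)))
      map₂_whisker_left := fun P Q Q' β => Cat.Hom₂.ext (NatTrans.ext (funext fun x => by
        refine (map₂_left P β x).trans ?_
        simp only [Cat.Hom₂.comp_app, Cat.eqToHom_app]
        rfl))
      map₂_whisker_right := fun β Q => Cat.Hom₂.ext (NatTrans.ext (funext fun x => by
        refine (map₂_right β Q x).trans ?_
        simp only [Cat.Hom₂.comp_app, Cat.eqToHom_app]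
        rfl)) }

/-- Constructor for 2-natural transformations between `Cat`-valued 2-functors. -/
def mkCatTrans {C : Type u₁} [Bicategory.{w₁, v₁} C] {F G : StrictPseudofunctor C Cat.{v₂, u₂}}
    (app : ∀ k : C, F.obj k ⥤ G.obj k)
    (naturality : ∀ {k k' : C} (P : k ⟶ k'),
      (F.map P).toFunctor ⋙ app k' = app k ⋙ (G.map P).toFunctor)
    (naturality₂ : ∀ {k k' : C} {P Q : k ⟶ k'} (β : P ⟶ Q) (x : F.obj k),
      (app k').map ((F.map₂ β).toNatTrans.app x) =
        eqToHom (congrArg (fun H => H.obj x) (naturality P)) ≫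
          (G.map₂ β).toNatTrans.app ((app k).obj x) ≫
            eqToHom (congrArg (fun H => H.obj x) (naturality Q)).symm) : F ⟶ G where
  app k := (app k).toCatHom
  naturality P := Cat.ext (naturality P)
  naturality₂ {k k' P Q} β := Cat.Hom₂.ext (NatTrans.ext (funext fun x => by
    rw [Cat.Hom₂.comp_app, Cat.Hom₂.comp_app, Cat.eqToHom_app, Cat.eqToHom_app]
    refine (congrArg (· ≫ _) (naturality₂ β x)).trans ?_
    simp only [Category.assoc, eqToHom_trans, eqToHom_refl]
    erw [Category.comp_id]
    rfl))

/-- Constructor for modifications between 2-natural transformations of `Cat`-valued 2-functors. -/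
def mkCatMod {C : Type u₁} [Bicategory.{w₁, v₁} C] {F G : StrictPseudofunctor C Cat.{v₂, u₂}}
    {η θ : F ⟶ G}
    (app : ∀ (k : C), (TwoNatTrans.app η k).toFunctor ⟶ (TwoNatTrans.app θ k).toFunctor)
    (naturality : ∀ {k k' : C} (P : k ⟶ k') (x : F.obj k),
      (app k').app ((F.map P).toFunctor.obj x) ≫
          eqToHom (congrArg (fun H => H.toFunctor.obj x) (TwoNatTrans.naturality θ P)) =
        eqToHom (congrArg (fun H => H.toFunctor.obj x) (TwoNatTrans.naturality η P)) ≫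
          (G.map P).toFunctor.map ((app k).app x)) : η ⟶ θ where
  app k := ⟨app k⟩
  naturality P := Cat.Hom₂.ext (NatTrans.ext (funext fun x => by
    rw [Cat.Hom₂.comp_app, Cat.Hom₂.comp_app, Cat.eqToHom_app, Cat.eqToHom_app]
    exact naturality P x))

namespace OneCell

/-- Postcomposition with a 1-cell. -/
abbrev post {x y : K} (T : x ⟶ y) (k : K) : OneCell.{r} k x ⥤ OneCell.{r} k y where
  obj f := ⟨f.hom ≫ T⟩
  map β := ⟨TwoCell.hom β ▷ T⟩

/-- Precomposition with a 1-cell. -/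
abbrev pre {x y : K} (P : x ⟶ y) (k : K) : OneCell.{r} y k ⥤ OneCell.{r} x k where
  obj f := ⟨P ≫ f.hom⟩
  map β := ⟨P ◁ TwoCell.hom β⟩

/-- Postcomposition with a 2-cell. -/
abbrev postMap {x y : K} {T T' : x ⟶ y} (β : T ⟶ T') (k : K) : post.{r} T k ⟶ post T' k where
  app f := ⟨f.hom ◁ β⟩
  naturality f g γ := by ext; simp [whisker_exchange]

/-- Precomposition with a 2-cell. -/
abbrev preMap {x y : K} {P P' : x ⟶ y} (β : P ⟶ P') (k : K) : pre.{r} P k ⟶ pre P' k where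
  app f := ⟨β ▷ f.hom⟩
  naturality f g γ := by ext; simp [whisker_exchange]

section PrecompositionMonad

variable {x : K} (S : Mnd x)

/-- The multiplication of the monad `- ∘ S`. -/
abbrev preMul (k : K) : pre.{r} S.S k ⋙ pre S.S k ⟶ pre S.S k where
  app N := ⟨(α_ S.S S.S N.hom).inv ≫ S.mul ▷ N.hom⟩
  naturality N N' β := by ext; simp [← whisker_exchange]

/-- The unit of the monad `- ∘ S`. -/
abbrev preUnit (k : K) : 𝟭 (OneCell.{r} x k) ⟶ pre S.S k where
  app N := ⟨(λ_ N.hom).inv ≫ S.unit ▷ N.hom⟩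
  naturality N N' β := by ext; simp [← whisker_exchange]

theorem preMul_left (k : K) (N : OneCell.{r} x k) :
    (pre S.S k).map ((preUnit S k).app N) ≫ (preMul S k).app N = 𝟙 ((pre S.S k).obj N) := by
  ext
  have h := congrArg (· ▷ N.hom) S.unit_right
  simp only [comp_whiskerRight] at h
  simp only [comp_hom, id_hom, whiskerLeft_comp, Category.assoc]
  rw [associator_inv_naturality_middle_assoc, h]
  simp

theorem preMul_right (k : K) (N : OneCell.{r} x k) :
    (preUnit S k).app ((pre S.S k).obj N) ≫ (preMul S k).app N = 𝟙 ((pre S.S k).obj N) := by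
  ext
  have h := congrArg (· ▷ N.hom) S.unit_left
  simp only [comp_whiskerRight] at h
  simp only [comp_hom, id_hom, Category.assoc]
  rw [associator_inv_naturality_left_assoc, h]
  simp

theorem preMul_assoc (k : K) (N : OneCell.{r} x k) :
    (pre S.S k).map ((preMul S k).app N) ≫ (preMul S k).app N =
      𝟙 ((pre S.S k).obj ((pre S.S k).obj ((pre S.S k).obj N))) ≫
        (preMul S k).app ((pre S.S k).obj N) ≫ (preMul S k).app N := by
  ext
  have h := congrArg (· ▷ N.hom) S.assoc
  simp only [comp_whiskerRight] at h
  simp only [comp_hom, whiskerLeft_comp, Category.assoc, Category.id_comp]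
  rw [associator_inv_naturality_middle_assoc, associator_inv_naturality_left_assoc, h]
  simp

end PrecompositionMonad

variable [Strict K]

theorem pre_id (x k : K) : pre.{r} (𝟙 x) k = 𝟭 _ :=
  CategoryTheory.Functor.ext (fun f => OneCell.ext (Strict.id_comp _)) fun f g γ => by
    ext; simp [Strict.leftUnitor_eqToIso]

theorem post_id (k x : K) : post.{r} (𝟙 x) k = 𝟭 _ :=
  CategoryTheory.Functor.ext (fun f => OneCell.ext (Strict.comp_id _)) fun f g γ => by
    ext; simp [Strict.rightUnitor_eqToIso]

theorem pre_comp {x y z : K} (P : x ⟶ y) (Q : y ⟶ z) (k : K) :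
    pre.{r} (P ≫ Q) k = pre Q k ⋙ pre P k :=
  CategoryTheory.Functor.ext (fun f => OneCell.ext (Strict.assoc _ _ _)) fun f g γ => by
    ext; simp [Strict.associator_eqToIso]

theorem post_comp {x y z : K} (P : x ⟶ y) (Q : y ⟶ z) (k : K) :
    post.{r} (P ≫ Q) k = post P k ⋙ post Q k :=
  CategoryTheory.Functor.ext (fun f => OneCell.ext (Strict.assoc _ _ _).symm) fun f g γ => by
    ext; simp [Strict.associator_eqToIso]

theorem pre_post {x y z t : K} (P : x ⟶ y) (T : z ⟶ t) :
    pre.{r} P z ⋙ post T x = post T y ⋙ pre P t :=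
  CategoryTheory.Functor.ext (fun f => OneCell.ext (Strict.assoc _ _ _)) fun f g γ => by
    ext; simp [Strict.associator_eqToIso]

theorem post_map_preMap {x y z t : K} {P P' : x ⟶ y} (β : P ⟶ P') (T : z ⟶ t)
    (f : OneCell.{r} y z) : (post T x).map ((preMap β z).app f) =
      eqToHom (congrArg (fun H => H.obj f) (pre_post P T)) ≫
        (preMap β t).app ((post T y).obj f) ≫
          eqToHom (congrArg (fun H => H.obj f) (pre_post P' T)).symm := by
  ext; simp [Strict.associator_eqToIso]

theorem pre_map_postMap {x y z t : K} (P : x ⟶ y) {T T' : z ⟶ t} (β : T ⟶ T')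
    (f : OneCell.{r} y z) : (pre P t).map ((postMap β y).app f) =
      eqToHom (congrArg (fun H => H.obj f) (pre_post P T)).symm ≫
        (postMap β x).app ((pre P z).obj f) ≫
          eqToHom (congrArg (fun H => H.obj f) (pre_post P T')) := by
  ext; simp [Strict.associator_eqToIso]

theorem preMul_naturality {x : K} (S : Mnd x) {k k' : K} (P : k ⟶ k') (N : OneCell.{r} x k) :
    (preMul S k').app ((post P x).obj N) ≫
        eqToHom (congrArg (fun H => H.obj N) (pre_post S.S P).symm) =
      eqToHom (congrArg (fun H => H.obj N) (show post P x ⋙ pre S.S k' ⋙ pre S.S k' =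
          (pre S.S k ⋙ pre S.S k) ⋙ post P x by
        rw [← Functor.assoc, ← pre_post, Functor.assoc, ← pre_post, Functor.assoc])) ≫
        (post P x).map ((preMul S k).app N) := by
  ext; simp [Strict.associator_eqToIso]

theorem preUnit_naturality {x : K} (S : Mnd x) {k k' : K} (P : k ⟶ k') (N : OneCell.{r} x k) :
    (preUnit S k').app ((post P x).obj N) ≫
        eqToHom (congrArg (fun H => H.obj N) (pre_post S.S P).symm) =
      𝟙 ((post P x).obj N) ≫ (post P x).map ((preUnit S k).app N) := by
  ext; simp [Strict.associator_eqToIso, Strict.leftUnitor_eqToIso]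

end OneCell

variable [Strict K]

/-- The 2-functor `K(-, x) : Kᵒᵖ ⟶ Cat`. -/
def homTo (x : K) : StrictPseudofunctor Kᵒᵖ Cat.{w, max r v} :=
  mkCatFunctor (fun k => OneCell.{r} k.unop x) (fun P => OneCell.pre P.unop x)
    (fun β => OneCell.preMap β.unop2 x) (fun k => OneCell.pre_id k.unop x)
    (fun P Q => OneCell.pre_comp Q.unop P.unop x)
    (fun P f => by ext; simp)
    (fun β γ f => by ext; simp)
    (fun P Q Q' β f => by ext; simp [Strict.associator_eqToIso])
    (fun β Q f => by ext; simp [Strict.associator_eqToIso])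

/-- The 2-functor `K(x, -) : K ⟶ Cat`. -/
def homFrom (x : K) : StrictPseudofunctor K Cat.{w, max r v} :=
  mkCatFunctor (fun k => OneCell.{r} x k) (fun P => OneCell.post P x)
    (fun β => OneCell.postMap β x) (fun k => OneCell.post_id x k)
    (fun P Q => OneCell.post_comp P Q x)
    (fun P f => by ext; simp)
    (fun β γ f => by ext; simp)
    (fun P Q Q' β f => by ext; simp [Strict.associator_eqToIso])
    (fun β Q f => by ext; simp [Strict.associator_eqToIso])

/-- The 2-natural transformation `T ∘ - : K(-, x) ⟶ K(-, y)`. -/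
def postcompTrans {x y : K} (T : x ⟶ y) : homTo.{r} x ⟶ homTo.{r} y :=
  mkCatTrans (fun k => OneCell.post T k.unop) (fun P => OneCell.pre_post P.unop T)
    (fun β f => OneCell.post_map_preMap β.unop2 T f)

/-- The 2-natural transformation `- ∘ P : K(y, -) ⟶ K(x, -)`. -/
def precompTrans {x y : K} (P : x ⟶ y) : homFrom.{r} y ⟶ homFrom.{r} x :=
  mkCatTrans (fun k => OneCell.pre P k) (fun Q => (OneCell.pre_post P Q).symm)
    (fun β f => OneCell.pre_map_postMap P β f)

end HomCategories

section Algebras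

variable {K : Type u} [Bicategory.{w, v} K]

/-- A `k`-indexed algebra of the monad `S`. -/
structure Alg {a : K} (S : Mnd a) (k : K) : Type (max v w) where
  carrier : k ⟶ a
  str : carrier ≫ S.S ⟶ carrier
  unit : carrier ◁ S.unit ≫ str = (ρ_ carrier).hom
  assoc : carrier ◁ S.mul ≫ str = (α_ carrier S.S S.S).inv ≫ str ▷ S.S ≫ str

/-- A morphism of `k`-indexed algebras. -/
@[ext]
structure AlgHom {a : K} {S : Mnd a} {k : K} (M N : Alg S k) : Type w where
  hom : M.carrier ⟶ N.carrier
  comm : M.str ≫ hom = hom ▷ S.S ≫ N.str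

namespace Alg

variable {a : K} {S : Mnd a} {k : K}

instance : Category.{w} (Alg S k) where
  Hom M N := AlgHom M N
  id M := ⟨𝟙 M.carrier, by simp⟩
  comp f g := ⟨f.hom ≫ g.hom, by
    rw [← Category.assoc, f.comm, Category.assoc, g.comm, comp_whiskerRight, Category.assoc]⟩

@[ext]
theorem hom_ext {M N : Alg S k} {f g : M ⟶ N} (h : AlgHom.hom f = AlgHom.hom g) : f = g :=
  AlgHom.ext h

@[simp]
theorem id_hom (M : Alg S k) : AlgHom.hom (𝟙 M) = 𝟙 M.carrier := rfl

@[simp]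
theorem comp_hom {M N P : Alg S k} (f : M ⟶ N) (g : N ⟶ P) :
    AlgHom.hom (f ≫ g) = AlgHom.hom f ≫ AlgHom.hom g := rfl

@[simp]
theorem eqToHom_hom {M N : Alg S k} (h : M = N) :
    AlgHom.hom (eqToHom h) = eqToHom (congrArg Alg.carrier h) := by
  subst h; rfl

theorem ext_of {M N : Alg S k} (h : M.carrier = N.carrier)
    (h' : M.str = eqToHom (by rw [h]) ≫ N.str ≫ eqToHom h.symm) : M = N := by
  obtain ⟨c, s, _, _⟩ := M
  obtain ⟨c', s', _, _⟩ := N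
  obtain rfl : c = c' := h
  obtain rfl : s = s' := by simpa using h'
  rfl

/-- Reindexing of an algebra along a 1-cell. -/
abbrev preObj {k' : K} (P : k' ⟶ k) (M : Alg S k) : Alg S k' where
  carrier := P ≫ M.carrier
  str := (α_ P M.carrier S.S).hom ≫ P ◁ M.str
  unit := by
    rw [comp_whiskerLeft]
    simp only [Category.assoc, Iso.inv_hom_id_assoc, ← whiskerLeft_comp, M.unit]
    simp
  assoc := by
    rw [comp_whiskerLeft]
    simp only [Category.assoc, Iso.inv_hom_id_assoc, ← whiskerLeft_comp, M.assoc]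
    simp

/-- The reindexing functor along a 1-cell. -/
abbrev pre {k' : K} (P : k' ⟶ k) (S : Mnd a) : Alg S k ⥤ Alg S k' where
  obj M := preObj P M
  map f :=
    { hom := P ◁ AlgHom.hom f
      comm := by
        dsimp only
        rw [Category.assoc, ← whiskerLeft_comp, AlgHom.comm]
        simp }

/-- Reindexing along a 2-cell. -/
abbrev preMap {k' : K} {P P' : k' ⟶ k} (β : P ⟶ P') (S : Mnd a) : pre P S ⟶ pre P' S where
  app M :=
    { hom := β ▷ M.carrier
      comm := by
        dsimp only
        rw [Category.assoc, whisker_exchange]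
        simp }
  naturality M N f := by ext; simp [whisker_exchange]

/-- The forgetful functor. -/
abbrev forget (S : Mnd a) (k : K) : Alg S k ⥤ OneCell.{w} k a where
  obj M := ⟨M.carrier⟩
  map f := ⟨AlgHom.hom f⟩

variable [Strict K]

theorem pre_id (k : K) (S : Mnd a) : pre (𝟙 k) S = 𝟭 _ :=
  CategoryTheory.Functor.ext
    (fun M => ext_of (Strict.id_comp _) (by
      simp [Strict.leftUnitor_eqToIso, Strict.associator_eqToIso]))
    fun f g γ => by ext; simp [Strict.leftUnitor_eqToIso]

theorem pre_comp {k k' k'' : K} (P : k'' ⟶ k') (Q : k' ⟶ k) (S : Mnd a) :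
    pre (P ≫ Q) S = pre Q S ⋙ pre P S :=
  CategoryTheory.Functor.ext
    (fun M => ext_of (Strict.assoc _ _ _) (by
      simp [Strict.associator_eqToIso]))
    fun f g γ => by ext; simp [Strict.associator_eqToIso]

end Alg

section InducedStr

variable {a₀ a : K} {I : a₀ ⟶ a} {S₀ : Mnd a₀} {S : Mnd a}

/-- The `S`-algebra structure on `I M` induced by `φ : S I ⟶ I S₀` and an `S₀`-algebra `(M, m)`. -/
abbrev Alg.inducedStr (φ : I ≫ S.S ⟶ S₀.S ≫ I) {k : K} (M : Alg S₀ k) :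
    (M.carrier ≫ I) ≫ S.S ⟶ M.carrier ≫ I :=
  (α_ M.carrier I S.S).hom ≫ M.carrier ◁ φ ≫ (α_ M.carrier S₀.S I).inv ≫ M.str ▷ I

theorem Alg.inducedStr_unit (φ : I ≫ S.S ⟶ S₀.S ≫ I)
    (unit : I ◁ S.unit ≫ φ = (ρ_ I).hom ≫ (λ_ I).inv ≫ S₀.unit ▷ I) {k : K} (M : Alg S₀ k) :
    (M.carrier ≫ I) ◁ S.unit ≫ inducedStr φ M = (ρ_ (M.carrier ≫ I)).hom := by
  have h1 := congrArg (M.carrier ◁ ·) unit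
  have h2 := congrArg (· ▷ I) M.unit
  simp only [whiskerLeft_comp, comp_whiskerRight] at h1 h2
  rw [comp_whiskerLeft]
  simp only [Category.assoc, Iso.inv_hom_id_assoc, reassoc_of% h1]
  rw [associator_inv_naturality_middle_assoc, h2]
  simp

theorem Alg.inducedStr_assoc (φ : I ≫ S.S ⟶ S₀.S ≫ I)
    (mul : I ◁ S.mul ≫ φ = (α_ I S.S S.S).inv ≫ φ ▷ S.S ≫
      (α_ S₀.S I S.S).hom ≫ S₀.S ◁ φ ≫ (α_ S₀.S S₀.S I).inv ≫ S₀.mul ▷ I)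
    {k : K} (M : Alg S₀ k) :
    (M.carrier ≫ I) ◁ S.mul ≫ inducedStr φ M =
      (α_ (M.carrier ≫ I) S.S S.S).inv ≫ inducedStr φ M ▷ S.S ≫ inducedStr φ M := by
  have h1 := congrArg (M.carrier ◁ ·) mul
  have h2 := congrArg (· ▷ I) M.assoc
  simp only [whiskerLeft_comp, comp_whiskerRight] at h1 h2
  rw [comp_whiskerLeft]
  simp only [Category.assoc, Iso.inv_hom_id_assoc, reassoc_of% h1]
  rw [associator_inv_naturality_middle_assoc, h2]
  simp only [inducedStr, comp_whiskerRight, Category.assoc]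
  rw [associator_naturality_left_assoc, ← whisker_exchange_assoc]
  simp

theorem Alg.inducedStr_comm (φ : I ≫ S.S ⟶ S₀.S ≫ I) {k : K} {M N : Alg S₀ k} (f : M ⟶ N) :
    inducedStr φ M ≫ AlgHom.hom f ▷ I = (AlgHom.hom f ▷ I) ▷ S.S ≫ inducedStr φ N := by
  have h1 := congrArg (· ▷ I) (AlgHom.comm f)
  simp only [comp_whiskerRight] at h1
  simp only [inducedStr, Category.assoc, h1]
  rw [associator_naturality_left_assoc, ← whisker_exchange_assoc]
  simp

end InducedStr

variable [Strict K]

/-- The 2-functor `S-Alg(-) : Kᵒᵖ ⟶ Cat` of indexed algebras. -/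
def algFunctor {a : K} (S : Mnd a) : StrictPseudofunctor Kᵒᵖ Cat.{w, max v w} :=
  mkCatFunctor (fun k => Alg S k.unop) (fun P => Alg.pre P.unop S)
    (fun β => Alg.preMap β.unop2 S) (fun k => Alg.pre_id k.unop S)
    (fun P Q => Alg.pre_comp Q.unop P.unop S)
    (fun P f => by ext; simp)
    (fun β γ f => by ext; simp)
    (fun P Q Q' β f => by ext; simp [Strict.associator_eqToIso])
    (fun β Q f => by ext; simp [Strict.associator_eqToIso])

/-- The forgetful 2-natural transformation `U : S-Alg(-) ⟶ K(-, a)`. -/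
def algForget {a : K} (S : Mnd a) : algFunctor S ⟶ homTo.{w} a :=
  mkCatTrans (fun k => Alg.forget S k.unop) (fun P => rfl)
    (fun β f => by erw [eqToHom_refl, eqToHom_refl, Category.id_comp, Category.comp_id]; rfl)

section Induced

variable {a₀ a : K} {I : a₀ ⟶ a} {S₀ : Mnd a₀} {S : Mnd a}

/-- The `S`-algebra `(I M, I m)` induced by an `S₀`-algebra `(M, m)`. -/
abbrev Alg.inducedObj (h : Compatible I S₀ S) {k : K} (M : Alg S₀ k) : Alg S k where
  carrier := M.carrier ≫ I
  str := Alg.inducedStr (eqToHom h.comm) M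
  unit := Alg.inducedStr_unit _ h.unit M
  assoc := Alg.inducedStr_assoc _ h.mul M

/-- The functor `S₀-Alg(k) ⥤ S-Alg(k)`, `(M, m) ↦ (I M, I m)`. -/
abbrev Alg.induced (h : Compatible I S₀ S) (k : K) : Alg S₀ k ⥤ Alg S k where
  obj M := Alg.inducedObj h M
  map f :=
    { hom := AlgHom.hom f ▷ I
      comm := Alg.inducedStr_comm _ f }

theorem Alg.pre_induced (h : Compatible I S₀ S) {k k' : K} (P : k' ⟶ k) :
    pre P S₀ ⋙ induced h k' = induced h k ⋙ pre P S :=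
  CategoryTheory.Functor.ext
    (fun M => ext_of (Strict.assoc _ _ _) (by
      simp [Alg.inducedStr, Strict.associator_eqToIso]))
    fun f g γ => by ext; simp [Strict.associator_eqToIso]

theorem Alg.induced_map_preMap (h : Compatible I S₀ S) {k k' : K} {P P' : k' ⟶ k} (β : P ⟶ P')
    (M : Alg S₀ k) : (induced h k').map ((preMap β S₀).app M) =
      eqToHom (congrArg (fun H => H.obj M) (pre_induced h P)) ≫
        (preMap β S).app ((induced h k).obj M) ≫
          eqToHom (congrArg (fun H => H.obj M) (pre_induced h P')).symm := by
  ext; simp [Strict.associator_eqToIso]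

/-- The 2-natural transformation `I_* : S₀-Alg(-) ⟶ S-Alg(-)`, `(M, m) ↦ (I M, I m)`. -/
def algInduced (h : Compatible I S₀ S) : algFunctor S₀ ⟶ algFunctor S :=
  mkCatTrans (fun k => Alg.induced h k.unop) (fun P => Alg.pre_induced h P.unop)
    (fun β f => Alg.induced_map_preMap h β.unop2 f)

end Induced

end Algebras

section RightModules

variable {K : Type u} [Bicategory.{w, v} K] {X₀ X : K} {I : X₀ ⟶ X}

/-- A `k`-indexed relative right `T`-module. -/
structure RightModule (T : RelMonad I) (k : K) : Type (max u v w) where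
  carrier : X₀ ⟶ k
  op : Operator I T.T carrier carrier
  unit : op.app (𝟙 X₀) (𝟙 X₀) (𝟙 X₀ ◁ T.unit) = 𝟙 (𝟙 X₀ ≫ carrier)
  assoc {o : K} (A C E : o ⟶ X₀) (f : A ≫ I ⟶ C ≫ T.T) (g : C ≫ I ⟶ E ≫ T.T) :
    op.app A E (f ≫ T.ext.app C E g) = op.app A C f ≫ op.app C E g

/-- A morphism of `k`-indexed relative right modules. -/
@[ext]
structure RightModuleHom {T : RelMonad I} {k : K} (M N : RightModule T k) : Type w where
  hom : M.carrier ⟶ N.carrier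
  comm {o : K} (A C : o ⟶ X₀) (f : A ≫ I ⟶ C ≫ T.T) :
    M.op.app A C f ≫ C ◁ hom = A ◁ hom ≫ N.op.app A C f

namespace RightModule

variable {T : RelMonad I} {k : K}

instance : Category.{w} (RightModule T k) where
  Hom M N := RightModuleHom M N
  id M := ⟨𝟙 M.carrier, by simp⟩
  comp f g := ⟨f.hom ≫ g.hom, fun A C h => by
    rw [whiskerLeft_comp, whiskerLeft_comp, ← Category.assoc, f.comm, Category.assoc, g.comm,
      Category.assoc]⟩

@[ext]
theorem hom_ext {M N : RightModule T k} {f g : M ⟶ N}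
    (h : RightModuleHom.hom f = RightModuleHom.hom g) : f = g :=
  RightModuleHom.ext h

@[simp]
theorem id_hom (M : RightModule T k) : RightModuleHom.hom (𝟙 M) = 𝟙 M.carrier := rfl

@[simp]
theorem comp_hom {M N P : RightModule T k} (f : M ⟶ N) (g : N ⟶ P) :
    RightModuleHom.hom (f ≫ g) = RightModuleHom.hom f ≫ RightModuleHom.hom g := rfl

@[simp]
theorem eqToHom_hom {M N : RightModule T k} (h : M = N) :
    RightModuleHom.hom (eqToHom h) = eqToHom (congrArg RightModule.carrier h) := by
  subst h; rfl

theorem ext_of {M N : RightModule T k} (h : M.carrier = N.carrier)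
    (h' : ∀ {o : K} (A C : o ⟶ X₀) (f : A ≫ I ⟶ C ≫ T.T), M.op.app A C f =
      eqToHom (by rw [h]) ≫ N.op.app A C f ≫ eqToHom (by rw [h])) : M = N := by
  obtain ⟨c, ⟨p, _, _, _⟩, _, _⟩ := M
  obtain ⟨c', ⟨p', _, _, _⟩, _, _⟩ := N
  obtain rfl : c = c' := h
  obtain rfl : @p = @p' := by
    funext o A C f
    simpa using h' A C f
  rfl

/-- The module `(G M, G (-)_m)`. -/
abbrev postObj {k' : K} (G : k ⟶ k') (M : RightModule T k) : RightModule T k' where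
  carrier := M.carrier ≫ G
  op :=
    { app := fun A C f => (α_ A M.carrier G).inv ≫ M.op.app A C f ▷ G ≫ (α_ C M.carrier G).hom
      index := fun P A C f => by rw [M.op.index]; simp
      left := fun C α f => by rw [M.op.left]; simp
      right := fun A _ _ f β => by rw [M.op.right]; simp }
  unit := by dsimp only; rw [M.unit]; simp
  assoc A C E f g := by dsimp only; rw [M.assoc]; simp

/-- Postcomposition of modules with a 1-cell. -/
abbrev post {k' : K} (G : k ⟶ k') (T : RelMonad I) : RightModule T k ⥤ RightModule T k' where
  obj M := postObj G M
  map f :=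
    { hom := RightModuleHom.hom f ▷ G
      comm := fun A C h => by
        have h1 := congrArg (· ▷ G) (RightModuleHom.comm f A C h)
        simp only [comp_whiskerRight] at h1
        simp only [Category.assoc]
        rw [← associator_naturality_middle, reassoc_of% h1]
        simp }

/-- Postcomposition of modules with a 2-cell. -/
abbrev postMap {k' : K} {G G' : k ⟶ k'} (β : G ⟶ G') (T : RelMonad I) :
    post G T ⟶ post G' T where
  app M :=
    { hom := M.carrier ◁ β
      comm := fun A C h => by
        simp only [Category.assoc]
        rw [← associator_naturality_right, ← whisker_exchange_assoc]
        simp }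
  naturality M N f := by ext; simp [whisker_exchange]

/-- The functor `(M, (-)_m) ↦ M`. -/
abbrev forget (T : RelMonad I) (k : K) : RightModule T k ⥤ OneCell.{max u w} X₀ k where
  obj M := ⟨M.carrier⟩
  map f := ⟨RightModuleHom.hom f⟩

/-- The relative right module `(T, (-)^†)`. -/
abbrev self (T : RelMonad I) : RightModule T X where
  carrier := T.T
  op := T.ext
  unit := T.unit_right
  assoc := T.assoc

/-- The functor `N ↦ (N T, N (-)^†)`. -/
abbrev free (T : RelMonad I) (k : K) : OneCell.{max u w} X k ⥤ RightModule T k where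
  obj N := postObj N.hom (self T)
  map β := (postMap (TwoCell.hom β) T).app (self T)
  map_id _ := by ext; simp
  map_comp _ _ := by ext; simp

variable [Strict K]

theorem post_id (k : K) (T : RelMonad I) : post (𝟙 k) T = 𝟭 _ :=
  CategoryTheory.Functor.ext
    (fun M => ext_of (Strict.comp_id _) (fun A C f => by
      simp [Strict.rightUnitor_eqToIso, Strict.associator_eqToIso]))
    fun f g γ => by ext; simp [Strict.rightUnitor_eqToIso]

theorem post_comp {k k' k'' : K} (P : k ⟶ k') (Q : k' ⟶ k'') (T : RelMonad I) :
    post (P ≫ Q) T = post P T ⋙ post Q T :=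
  CategoryTheory.Functor.ext
    (fun M => ext_of (Strict.assoc _ _ _).symm (fun A C f => by
      simp [Strict.associator_eqToIso]))
    fun f g γ => by ext; simp [Strict.associator_eqToIso]

theorem post_free {k k' : K} (G : k ⟶ k') (T : RelMonad I) :
    OneCell.post G X ⋙ free T k' = free T k ⋙ post G T :=
  CategoryTheory.Functor.ext
    (fun M => ext_of (Strict.assoc _ _ _).symm (fun A C f => by
      simp [Strict.associator_eqToIso]))
    fun f g γ => by ext; simp [Strict.associator_eqToIso]

theorem free_map_postMap {k k' : K} {G G' : k ⟶ k'} (β : G ⟶ G') (T : RelMonad I)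
    (N : OneCell.{max u w} X k) : (free T k').map ((OneCell.postMap β X).app N) =
      eqToHom (congrArg (fun H => H.obj N) (post_free G T)) ≫
        (postMap β T).app ((free T k).obj N) ≫
          eqToHom (congrArg (fun H => H.obj N) (post_free G' T)).symm := by
  ext; simp [Strict.associator_eqToIso]

end RightModule

variable [Strict K]

/-- The 2-functor `Mod_T(-) : K ⟶ Cat` of relative right `T`-modules. -/
def modFunctor (T : RelMonad I) : StrictPseudofunctor K Cat.{w, max u v w} :=
  mkCatFunctor (fun k => RightModule T k) (fun P => RightModule.post P T)
    (fun β => RightModule.postMap β T) (fun k => RightModule.post_id k T)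
    (fun P Q => RightModule.post_comp P Q T)
    (fun P f => by ext; simp)
    (fun β γ f => by ext; simp)
    (fun P Q Q' β f => by ext; simp [Strict.associator_eqToIso])
    (fun β Q f => by ext; simp [Strict.associator_eqToIso])

/-- The 2-natural transformation `J₀* : Mod_T(-) ⟶ K(X₀, -)`, `(M, (-)_m) ↦ M`. -/
def modForget (T : RelMonad I) : modFunctor T ⟶ homFrom.{max u w} X₀ :=
  mkCatTrans (fun k => RightModule.forget T k) (fun P => rfl)
    (fun β f => by erw [eqToHom_refl, eqToHom_refl, Category.id_comp, Category.comp_id]; rfl)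

/-- The 2-natural transformation `U* : K(X, -) ⟶ Mod_T(-)`, `N ↦ (N T, N (-)^†)`. -/
def modFree (T : RelMonad I) : homFrom.{max u w} X ⟶ modFunctor T :=
  mkCatTrans (fun k => RightModule.free T k) (fun P => RightModule.post_free P T)
    (fun β f => RightModule.free_map_postMap β T f)

theorem RightModule.unit_naturality (T : RelMonad I) {k k' : K} (P : k ⟶ k')
    (N : OneCell.{max u w} X k) :
    (OneCell.preMap T.unit k').app ((OneCell.post P X).obj N) ≫
        eqToHom (congrArg (fun H => H.obj N) (congrArg (· ⋙ forget T k') (post_free P T))) =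
      eqToHom (congrArg (fun H => H.obj N) (OneCell.pre_post I P).symm) ≫
        (OneCell.post P X₀).map ((OneCell.preMap T.unit k).app N) := by
  ext; simp [Strict.associator_eqToIso]

/-- The modification `t : - ∘ I ⟶ J₀* U*`, with components `N t : N I ⟶ N T`. -/
def modUnit (T : RelMonad I) :
    precompTrans.{max u w} I ⟶ modFree T ≫ modForget T :=
  mkCatMod (fun k => OneCell.preMap T.unit k) (fun P N => RightModule.unit_naturality T P N)

/-- The monad `- ∘ S` on `K(x, -)` induced by a monad `S` on `x`. -/
def precompMnd {x : K} (S : Mnd x) : Mnd (homFrom.{r} x) where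
  S := precompTrans S.S
  mul := mkCatMod (fun k => OneCell.preMul S k) (fun P N => OneCell.preMul_naturality S P N)
  unit := mkCatMod (fun k => OneCell.preUnit S k) (fun P N => OneCell.preUnit_naturality S P N)
  unit_left := TwoMod.ext (funext fun k => Cat.Hom₂.ext (NatTrans.ext (funext fun N =>
    OneCell.preMul_left S k N)))
  unit_right := TwoMod.ext (funext fun k => Cat.Hom₂.ext (NatTrans.ext (funext fun N =>
    OneCell.preMul_right S k N)))
  assoc := TwoMod.ext (funext fun k => Cat.Hom₂.ext (NatTrans.ext (funext fun N =>
    OneCell.preMul_assoc S k N)))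

end RightModules

section Liftings

variable {K : Type u} [Bicategory.{w, v} K] [Strict K] {X₀ X : K} {I : X₀ ⟶ X}

/-- The algebra `A_k(x)`. -/
abbrev algAt {S : Mnd X} {P : StrictPseudofunctor Kᵒᵖ Cat.{w, max v w}} (A : P ⟶ algFunctor S)
    {k : K} (x : P.obj (op k)) : Alg S k :=
  (TwoNatTrans.app A (op k)).toFunctor.obj x

/-- The 2-cell underlying the component at `x` of a modification. -/
abbrev algCell {S : Mnd X} {P : StrictPseudofunctor Kᵒᵖ Cat.{w, max v w}}
    {A A' : P ⟶ algFunctor S} (Γ : A ⟶ A') {k : K} (x : P.obj (op k)) :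
    (algAt A x).carrier ⟶ (algAt A' x).carrier :=
  AlgHom.hom ((TwoMod.app Γ (op k)).toNatTrans.app x)

theorem algAt_carrier {S₀ : Mnd X₀} {S : Mnd X} {L : algFunctor S₀ ⟶ algFunctor S} {T : X₀ ⟶ X}
    (hL : L ≫ algForget S = algForget S₀ ≫ postcompTrans T) {k : K} (M : Alg S₀ k) :
    (algAt L M).carrier = M.carrier ≫ T :=
  congrArg (fun F : algFunctor S₀ ⟶ homTo.{w} X =>
    OneCell.hom ((TwoNatTrans.app F (op k)).toFunctor.obj M)) hL

/-- A lifting of the relative monad `T` to the algebras of `(S, S₀)`: a relative monad on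
`I_* : S₀-Alg(-) ⟶ S-Alg(-)` lying over `T`, whose extension operator and unit are those of `T`
on underlying 2-cells. -/
structure AlgLifting (T : RelMonad I) {S₀ : Mnd X₀} {S : Mnd X} (h : Compatible I S₀ S) where
  monad : RelMonad (algInduced h)
  forget_comm : monad.T ≫ algForget S = algForget S₀ ≫ postcompTrans T.T
  ext_induced {P : StrictPseudofunctor Kᵒᵖ Cat.{w, max v w}} (A C : P ⟶ algFunctor S₀)
    (f : A ≫ algInduced h ⟶ C ≫ monad.T) {k : K} (x : P.obj (op k)) :
    algCell (monad.ext.app A C f) x =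
      eqToHom (algAt_carrier forget_comm (algAt A x)) ≫
        T.ext.app (algAt A x).carrier (algAt C x).carrier
          (algCell f x ≫ eqToHom (algAt_carrier forget_comm (algAt C x))) ≫
        eqToHom (algAt_carrier forget_comm (algAt C x)).symm
  unit_induced {k : K} (M : Alg S₀ k) :
    algCell monad.unit M =
      M.carrier ◁ T.unit ≫ eqToHom (algAt_carrier forget_comm M).symm

/-- The free algebra `(S, m)`. -/
def freeAlg (S : Mnd X) : Alg S X where
  carrier := S.S
  str := S.mul
  unit := S.unit_right
  assoc := by rw [S.assoc, Iso.inv_hom_id_assoc]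

/-- The module `A_k(x)`. -/
abbrev modAt {T : RelMonad I} {P : StrictPseudofunctor K Cat.{w, max u v w}}
    (A : P ⟶ modFunctor T) {k : K} (x : P.obj k) : RightModule T k :=
  (TwoNatTrans.app A k).toFunctor.obj x

/-- The 2-cell underlying the component at `x` of a modification. -/
abbrev modCell {T : RelMonad I} {P : StrictPseudofunctor K Cat.{w, max u v w}}
    {A A' : P ⟶ modFunctor T} (Γ : A ⟶ A') {k : K} (x : P.obj k) :
    (modAt A x).carrier ⟶ (modAt A' x).carrier :=
  RightModuleHom.hom ((TwoMod.app Γ k).toNatTrans.app x)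

theorem modAt_carrier {T : RelMonad I} {S₀ : X₀ ⟶ X₀} {L : modFunctor T ⟶ modFunctor T}
    (hL : modForget T ≫ precompTrans S₀ = L ≫ modForget T) {k : K} (M : RightModule T k) :
    (modAt L M).carrier = S₀ ≫ M.carrier :=
  congrArg (fun F : modFunctor T ⟶ homFrom.{max u w} X₀ =>
    OneCell.hom ((TwoNatTrans.app F k).toFunctor.obj M)) hL.symm

theorem precompTrans_comm {S₀ : X₀ ⟶ X₀} {S : X ⟶ X} (h : I ≫ S = S₀ ≫ I) :
    precompTrans.{r} S ≫ precompTrans I = precompTrans I ≫ precompTrans S₀ :=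
  TwoNatTrans.ext (funext fun k => Cat.ext
    (show OneCell.pre S k ⋙ OneCell.pre I k = OneCell.pre I k ⋙ OneCell.pre S₀ k by
      rw [← OneCell.pre_comp, ← OneCell.pre_comp, h]))

/-- A lifting of the monad `S` to the relative right modules of `T`: a monad `S̃` on `Mod_T(-)`
and a modification `d* : U* (- ∘ S) ⟶ S̃ U*`, such that `(S̃, - ∘ S₀)` is compatible with `J₀*`,
`(U*, d*) : (K(X, -), - ∘ S) ⟶ (Mod_T(-), S̃)` is a morphism of `Mnd([K, Cat]ᵒᵖ)ᵒᵖ`,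
`t : (- ∘ I, 1) ⟶ (J₀*, 1)(U*, d*)` is a 2-cell there, and the action on `S̃(M, (-)_m)` is
`f ↦ (f_{S̃T} · t S₀ A)_m`. -/
structure ModLifting (T : RelMonad I) {S₀ : Mnd X₀} {S : Mnd X} (h : Compatible I S₀ S) where
  monad : Mnd (modFunctor T)
  dstar : precompTrans S.S ≫ modFree T ⟶ modFree T ≫ monad.S
  compat : Compatible (modForget T) monad (precompMnd S₀)
  mor : IsMndMor (precompMnd S) monad (modFree T) dstar
  unit : IsMndTrans (precompMnd S) (precompMnd S₀) (eqToHom (precompTrans_comm h.comm))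
    (mndMorComp dstar (eqToHom compat.comm.symm)) (modUnit T)
  action {k : K} (M : RightModule T k) {o : K} (A C : o ⟶ X₀) (f : A ≫ I ⟶ C ≫ T.T) :
    (modAt monad.S M).op.app A C f =
      eqToHom (by rw [modAt_carrier compat.comm, Strict.assoc]) ≫
        M.op.app (A ≫ S₀.S) (C ≫ S₀.S)
          ((A ≫ S₀.S) ◁ T.unit ≫
            eqToHom (by rw [modAt_carrier compat.comm, Strict.assoc]) ≫
            (modAt monad.S (RightModule.self T)).op.app A C f ≫
            eqToHom (by rw [modAt_carrier compat.comm, Strict.assoc])) ≫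
        eqToHom (by rw [modAt_carrier compat.comm, Strict.assoc])

end Liftings

end RelBeck

/-!
The dictionary between distributive laws and liftings rests on two observations: free algebras
detect the structure map of `T̂(M, m)`, and the action condition detects the operator of
`S̃(M, (-)_m)`.

For algebras, a distributive law `d` makes `T M` an `S`-algebra with structure map `T m · d M`, and
the extension axiom of `d` says precisely that the extension of `T` preserves algebra morphisms
(`RelDistLaw.ext_comm`). Conversely, `m : S₀ M ⟶ M` is a morphism of algebras from the free algebra
on `M`, so `T m` is one between the lifted algebras, and the structure map of `T̂(M, m)` has to be
`T m · d M` for the 2-cell `d` read off from `T̂(S₀, m₀)` (`AlgLifting.str_eq`). A lifting is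
determined by its structure maps (`AlgLifting.ext_str`). The axioms of a distributive law for this
`d` are the algebra axioms for `T̂(S₀, m₀)`, the unit being an algebra morphism, and, for the
extension axiom, the fact that extending preserves algebra morphisms. The last fact
(`AlgLifting.str_ext`) holds in the 2-category of 2-functors, and reaches single algebras through
the Yoneda lemma: a `k`-indexed algebra is a 2-natural transformation out of `K(-, k)`. It is
applied to `d C · S f`, the algebra morphism from the free algebra on `I A` that extends `f`
(`distExt_comm`, `unit_distExt`).

For modules, `d` turns `(M, (-)_m)` into `(M S₀, f ↦ (dB · S f)_m)`, and `N d` is a module morphism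
by the extension axiom (`RelDistLaw.dstar_comm`). Conversely, the modification axiom forces
`d*_N = N d` for the component `d` of `d*` at the identity (`ModLifting.cell_eq`). As this component
is a module morphism compatible with `t`, one has `f_{S̃T} · t S₀ A = dB · S f`
(`ModLifting.distExt_eq`), so that the action condition expresses the operator of every
`S̃(M, (-)_m)` by `d` (`ModLifting.op_eq`). In particular `d`, being a module morphism into `S̃T`,
satisfies the extension axiom. The underlying 1-cells and 2-cells of `S̃`, of its multiplication and
of its unit are prescribed by compatibility with `- ∘ S₀`, so `d` determines the lifting
(`ModLifting.ext_dist`).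

Strictness of the 2-categories is an equality of 1-cells, and values of 2-natural transformations
are known only up to such equalities. The cells involved are compared after transport along
`eqToHom`.
-/

namespace RelBeck

/-! ### Algebra morphisms into `T` of an algebra -/

section Operators

variable {B : Type u} [Bicategory.{w, v} B]

/-- Transport of the value of an operator along equalities of 1-cells: a 2-natural transformation
commutes with reindexing only up to propositional equality of 1-cells. -/
theorem Operator.app_congr {x y z z' : B} {F : x ⟶ z} {G : y ⟶ z} {F' : x ⟶ z'} {G' : y ⟶ z'}
    (op : Operator F G F' G') {o : B} {A A' : o ⟶ x} {C C' : o ⟶ y} (hA : A = A') (hC : C = C')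
    (f : A ≫ F ⟶ C ≫ G) :
    op.app A C f = eqToHom (by rw [hA]) ≫
      op.app A' C' (eqToHom (by rw [hA]) ≫ f ≫ eqToHom (by rw [hC])) ≫ eqToHom (by rw [hC]) := by
  subst hA hC; simp

variable {a₀ a : B} {I : a₀ ⟶ a} {S₀ : Mnd a₀} {S : Mnd a} {T : RelMonad I}
  {h : Compatible I S₀ S}

/-- The unit law of a module, at an arbitrary 1-cell `A` in place of the identity. -/
theorem RightModule.op_unit {k : B} (M : RightModule T k) {o : B} (A : o ⟶ a₀) :
    M.op.app A A (A ◁ T.unit) = 𝟙 (A ≫ M.carrier) := by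
  have h1 : A ◁ T.unit = (ρ_ A).inv ▷ I ≫ ((α_ A (𝟙 a₀) I).hom ≫ A ◁ 𝟙 a₀ ◁ T.unit ≫
      (α_ A (𝟙 a₀) T.T).inv) ≫ (ρ_ A).hom ▷ T.T := by
    simp
  rw [h1, M.op.left, M.op.right, M.op.index, M.unit]
  simp

@[ext]
theorem RelDistLaw.ext_d {D D' : RelDistLaw T h} (hd : D.d = D'.d) : D = D' := by
  cases D; cases D'; congr

/-- For algebras `M` and `N`, a 2-cell `f : I M ⟶ T N` is a morphism of algebras exactly when
`f · I m` is `T n · d N · S f`. -/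
theorem inducedStr_comm_iff (d : T.T ≫ S.S ⟶ S₀.S ≫ T.T) {k : B} (M N : Alg S₀ k)
    (f : M.carrier ≫ I ⟶ N.carrier ≫ T.T) :
    Alg.inducedStr (eqToHom h.comm) M ≫ f = f ▷ S.S ≫ Alg.inducedStr d N ↔
      M.str ▷ I ≫ f = distExt T h d M.carrier N.carrier f ≫ N.str ▷ T.T := by
  have e : (α_ M.carrier S₀.S I).hom ≫ M.carrier ◁ eqToHom h.comm.symm ≫
      (α_ M.carrier I S.S).inv ≫ Alg.inducedStr (eqToHom h.comm) M ≫ f = M.str ▷ I ≫ f := by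
    simp
  rw [← e, distExt]
  constructor
  · intro hf
    rw [hf]; simp
  · intro hf
    simp only [Category.assoc, Iso.cancel_iso_hom_left] at hf
    rw [whiskerLeft_eqToHom, eqToHom_comp_iff] at hf
    simp only [eqToHom_trans_assoc, eqToHom_refl, Category.id_comp, Iso.cancel_iso_inv_left] at hf
    simpa only [Alg.inducedStr, Category.assoc] using hf

/-- The extension of an algebra morphism `I M ⟶ T N` is an algebra morphism `T M ⟶ T N`: by
naturality of the extension in both variables, this is the extension axiom of `d`. -/
theorem RelDistLaw.ext_comm (D : RelDistLaw T h) {k : B} (M N : Alg S₀ k)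
    (f : M.carrier ≫ I ⟶ N.carrier ≫ T.T)
    (hf : Alg.inducedStr (eqToHom h.comm) M ≫ f = f ▷ S.S ≫ Alg.inducedStr D.d N) :
    Alg.inducedStr D.d M ≫ T.ext.app M.carrier N.carrier f =
      T.ext.app M.carrier N.carrier f ▷ S.S ≫ Alg.inducedStr D.d N := by
  rw [inducedStr_comm_iff (h := h)] at hf
  simp only [Alg.inducedStr, Category.assoc]
  rw [← T.ext.left, hf, T.ext.right]
  have h1 := D.extension M.carrier N.carrier f
  rw [reassoc_of% h1]

/-- The unit of `T` at an algebra is an algebra morphism. -/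
theorem RelDistLaw.unit_comm (D : RelDistLaw T h) {k : B} (M : Alg S₀ k) :
    Alg.inducedStr (eqToHom h.comm) M ≫ M.carrier ◁ T.unit =
      (M.carrier ◁ T.unit) ▷ S.S ≫ Alg.inducedStr D.d M := by
  have h1 := congrArg (M.carrier ◁ ·) D.relUnit
  simp only [whiskerLeft_comp] at h1
  simp only [Alg.inducedStr, Category.assoc]
  rw [← whisker_exchange, associator_naturality_middle_assoc, reassoc_of% h1]
  simp

end Operators

/-! ### The functors on algebras given by a distributive law -/

section AlgebraFunctors

variable {K : Type u} [Bicategory.{w, v} K] [Strict K] {X₀ X : K} {I : X₀ ⟶ X}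
  {S₀ : Mnd X₀} {S : Mnd X} {T : RelMonad I} {h : Compatible I S₀ S}

namespace RelDistLaw

variable (D : RelDistLaw T h)

/-- The `S`-algebra `(T M, T m · d M)` of an `S₀`-algebra `(M, m)`. -/
abbrev algObj {k : K} (M : Alg S₀ k) : Alg S k where
  carrier := M.carrier ≫ T.T
  str := Alg.inducedStr D.d M
  unit := Alg.inducedStr_unit _ D.unit M
  assoc := Alg.inducedStr_assoc _ D.mul M

/-- The functor `(M, m) ↦ (T M, T m · d M)`. -/
abbrev algMap (k : K) : Alg S₀ k ⥤ Alg S k where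
  obj M := D.algObj M
  map f :=
    { hom := AlgHom.hom f ▷ T.T
      comm := Alg.inducedStr_comm _ f }

theorem pre_algMap {k k' : K} (P : k' ⟶ k) :
    Alg.pre P S₀ ⋙ D.algMap k' = D.algMap k ⋙ Alg.pre P S :=
  CategoryTheory.Functor.ext
    (fun M => Alg.ext_of (Strict.assoc _ _ _) (by
      simp [Alg.inducedStr, Strict.associator_eqToIso]))
    fun f g γ => by ext; simp [Strict.associator_eqToIso]

theorem algMap_map_preMap {k k' : K} {P P' : k' ⟶ k} (β : P ⟶ P')
    (M : Alg S₀ k) : (D.algMap k').map ((Alg.preMap β S₀).app M) =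
      eqToHom (congrArg (fun H => H.obj M) (D.pre_algMap P)) ≫
        (Alg.preMap β S).app ((D.algMap k).obj M) ≫
          eqToHom (congrArg (fun H => H.obj M) (D.pre_algMap P')).symm := by
  ext; simp [Strict.associator_eqToIso]

/-- The 2-natural transformation `(M, m) ↦ (T M, T m · d M)`. -/
def algTrans : algFunctor S₀ ⟶ algFunctor S :=
  mkCatTrans (fun k => D.algMap k.unop) (fun P => D.pre_algMap P.unop)
    (fun β f => D.algMap_map_preMap β.unop2 f)

end RelDistLaw
end AlgebraFunctors

/-! ### Modifications into the 2-functor of algebras -/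

section AlgebraModifications

variable {K : Type u} [Bicategory.{w, v} K] [Strict K] {X : K} {S : Mnd X}
  {P : StrictPseudofunctor Kᵒᵖ Cat.{w, max v w}}

/-- The 2-cell underlying the action of `A_k` on a morphism. -/
abbrev algMapCell (A : P ⟶ algFunctor S) {k : K} {x y : P.obj (op k)} (g : x ⟶ y) :
    (algAt A x).carrier ⟶ (algAt A y).carrier :=
  AlgHom.hom ((TwoNatTrans.app A (op k)).toFunctor.map g)

theorem algAt_reindex (A : P ⟶ algFunctor S) {k k' : K} (Q : k' ⟶ k) (x : P.obj (op k)) :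
    algAt A ((P.map Q.op).toFunctor.obj x) = Alg.preObj Q (algAt A x) :=
  congrArg (fun H => H.toFunctor.obj x) (TwoNatTrans.naturality A Q.op)

theorem algAt_reindex_carrier (A : P ⟶ algFunctor S) {k k' : K} (Q : k' ⟶ k)
    (x : P.obj (op k)) :
    (algAt A ((P.map Q.op).toFunctor.obj x)).carrier = Q ≫ (algAt A x).carrier :=
  congrArg Alg.carrier (algAt_reindex A Q x)

/-- The modification axiom, on underlying 2-cells. -/
theorem algCell_reindex {A A' : P ⟶ algFunctor S} (Γ : A ⟶ A') {k k' : K} (Q : k' ⟶ k)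
    (x : P.obj (op k)) :
    algCell Γ ((P.map Q.op).toFunctor.obj x) =
      eqToHom (algAt_reindex_carrier A Q x) ≫ Q ◁ algCell Γ x ≫
        eqToHom (algAt_reindex_carrier A' Q x).symm := by
  have h1 := congrArg (fun z => (z.toNatTrans.app x)) (TwoMod.naturality Γ Q.op)
  simp only [Cat.Hom₂.comp_app, Cat.eqToHom_app] at h1
  have h2 := congrArg AlgHom.hom h1
  have h3 : algCell Γ ((P.map Q.op).toFunctor.obj x) ≫
      eqToHom (algAt_reindex_carrier A' Q x) =
      eqToHom (algAt_reindex_carrier A Q x) ≫ Q ◁ algCell Γ x := by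
    rw [← Alg.eqToHom_hom (algAt_reindex A Q x), ← Alg.eqToHom_hom (algAt_reindex A' Q x)]
    exact h2
  rw [← Category.assoc, ← h3]; simp

theorem algCell_naturality {A A' : P ⟶ algFunctor S} (Γ : A ⟶ A') {k : K} {x y : P.obj (op k)}
    (g : x ⟶ y) : algMapCell A g ≫ algCell Γ y = algCell Γ x ≫ algMapCell A' g :=
  congrArg AlgHom.hom ((TwoMod.app Γ (op k)).toNatTrans.naturality g)

theorem algMod_ext {A A' : P ⟶ algFunctor S} {Γ Γ' : A ⟶ A'}
    (e : ∀ {k : K} (x : P.obj (op k)), algCell Γ x = algCell Γ' x) : Γ = Γ' :=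
  TwoMod.ext (funext fun k => Cat.Hom₂.ext (NatTrans.ext (funext fun x =>
    AlgHom.ext (e (k := k.unop) x))))

/-- A modification into `S-Alg(-)`, from its underlying 2-cells. -/
def mkAlgMod {A A' : P ⟶ algFunctor S}
    (c : ∀ {k : K} (x : P.obj (op k)), (algAt A x).carrier ⟶ (algAt A' x).carrier)
    (comm : ∀ {k : K} (x : P.obj (op k)),
      (algAt A x).str ≫ c x = c x ▷ S.S ≫ (algAt A' x).str)
    (naturality : ∀ {k : K} {x y : P.obj (op k)} (g : x ⟶ y),
      algMapCell A g ≫ c y = c x ≫ algMapCell A' g)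
    (reindex : ∀ {k k' : K} (Q : k' ⟶ k) (x : P.obj (op k)),
      c ((P.map Q.op).toFunctor.obj x) = eqToHom (algAt_reindex_carrier A Q x) ≫ Q ◁ c x ≫
        eqToHom (algAt_reindex_carrier A' Q x).symm) : A ⟶ A' :=
  mkCatMod (fun k =>
    { app := fun x => (⟨c (k := k.unop) x, comm (k := k.unop) x⟩ :
        AlgHom (algAt A (k := k.unop) x) (algAt A' (k := k.unop) x))
      naturality := fun x y g => AlgHom.ext (naturality (k := k.unop) g) })
    (fun {k k'} Q x => AlgHom.ext (by
      have h1 : c (k := k'.unop) ((P.map Q).toFunctor.obj x) ≫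
          eqToHom (algAt_reindex_carrier A' Q.unop x) =
          eqToHom (algAt_reindex_carrier A Q.unop x) ≫ Q.unop ◁ c (k := k.unop) x := by
        refine (congrArg (· ≫ _) (reindex (k := k.unop) (k' := k'.unop) Q.unop x)).trans ?_
        simp
      rw [← Alg.eqToHom_hom (algAt_reindex A Q.unop x),
        ← Alg.eqToHom_hom (algAt_reindex A' Q.unop x)] at h1
      exact h1))

end AlgebraModifications

/-! ### The lifting to algebras given by a distributive law -/

section AlgebraLifting

variable {K : Type u} [Bicategory.{w, v} K] [Strict K] {X₀ X : K} {I : X₀ ⟶ X}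
  {S₀ : Mnd X₀} {S : Mnd X} {T : RelMonad I} {h : Compatible I S₀ S}

namespace RelDistLaw

variable (D : RelDistLaw T h)

/-- The extension operator of `T`, applied to the underlying 2-cells of a modification. -/
def algExt {P : StrictPseudofunctor Kᵒᵖ Cat.{w, max v w}}
    (A C : P ⟶ algFunctor S₀) (f : A ≫ algInduced h ⟶ C ≫ D.algTrans) :
    A ≫ D.algTrans ⟶ C ≫ D.algTrans :=
  mkAlgMod
    (fun x => T.ext.app (algAt A x).carrier (algAt C x).carrier (algCell f x))
    (fun {k} x => D.ext_comm (algAt A x) (algAt C x) (algCell f x)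
      (AlgHom.comm ((TwoMod.app f (op k)).toNatTrans.app x)))
    (fun {k x y} g => by
      have h1 : algMapCell A g ▷ I ≫ algCell f y = algCell f x ≫ algMapCell C g ▷ T.T :=
        algCell_naturality f g
      exact (T.ext.left _ _ _).symm.trans ((congrArg _ h1).trans (T.ext.right _ _ _)))
    (fun {k k'} Q x => by
      -- The carriers of `A` and `C` at `Q^* x` are only propositionally `Q^*` of the
      -- carriers at `x`, so the reindexing axiom of the extension is transported along
      -- these equalities.
      have hA := algAt_reindex_carrier A Q x
      have hC := algAt_reindex_carrier C Q x
      let g : (algAt A x).carrier ≫ I ⟶ (algAt C x).carrier ≫ T.T := algCell f x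
      let g' : (algAt A ((P.map Q.op).toFunctor.obj x)).carrier ≫ I ⟶
        (algAt C ((P.map Q.op).toFunctor.obj x)).carrier ≫ T.T :=
        algCell f ((P.map Q.op).toFunctor.obj x)
      have h1 : g' = eqToHom (by rw [hA, Strict.assoc]) ≫ Q ◁ g ≫
        eqToHom (by rw [hC, Strict.assoc]) := algCell_reindex f Q x
      have h2 : T.ext.app _ _ g' = eqToHom (by rw [hA, Strict.assoc]) ≫ Q ◁ T.ext.app _ _ g ≫
          eqToHom (by rw [hC, Strict.assoc]) := by
        have h3 := T.ext.index Q _ _ g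
        simp only [Strict.associator_eqToIso, eqToIso.hom, eqToIso.inv] at h3
        rw [T.ext.app_congr hA hC, h1]
        simp only [Category.assoc, eqToHom_trans, eqToHom_trans_assoc]
        rw [h3]
        simp
      exact h2)

theorem algExt_index {P P' : StrictPseudofunctor Kᵒᵖ Cat.{w, max v w}} (F : P' ⟶ P)
    (A C : P ⟶ algFunctor S₀) (f : A ≫ algInduced h ⟶ C ≫ D.algTrans) :
    D.algExt (F ≫ A) (F ≫ C) ((α_ F A (algInduced h)).hom ≫ F ◁ f ≫
        (α_ F C D.algTrans).inv) =
      (α_ F A D.algTrans).hom ≫ F ◁ D.algExt A C f ≫ (α_ F C D.algTrans).inv :=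
  algMod_ext fun {k} x => by
    let y := (TwoNatTrans.app F (op k)).toFunctor.obj x
    let g : (algAt A y).carrier ≫ I ⟶ (algAt C y).carrier ≫ T.T := algCell f y
    change T.ext.app _ _ (𝟙 _ ≫ g ≫ 𝟙 _) = 𝟙 _ ≫ T.ext.app _ _ g ≫ 𝟙 _
    simp

theorem algExt_left {P : StrictPseudofunctor Kᵒᵖ Cat.{w, max v w}}
    {A A' : P ⟶ algFunctor S₀} (C : P ⟶ algFunctor S₀) (γ : A' ⟶ A)
    (f : A ≫ algInduced h ⟶ C ≫ D.algTrans) :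
    D.algExt A' C (γ ▷ algInduced h ≫ f) = γ ▷ D.algTrans ≫ D.algExt A C f :=
  algMod_ext fun x => T.ext.left _ (algCell γ x) (algCell f x)

theorem algExt_right {P : StrictPseudofunctor Kᵒᵖ Cat.{w, max v w}}
    (A : P ⟶ algFunctor S₀) {C C' : P ⟶ algFunctor S₀}
    (f : A ≫ algInduced h ⟶ C ≫ D.algTrans) (γ : C ⟶ C') :
    D.algExt A C' (f ≫ γ ▷ D.algTrans) = D.algExt A C f ≫ γ ▷ D.algTrans :=
  algMod_ext fun x => T.ext.right _ (algCell f x) (algCell γ x)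

/-- The unit of `T`, at the underlying 1-cells of algebras. -/
def algUnit : algInduced h ⟶ D.algTrans :=
  mkAlgMod (fun {k} (M : Alg S₀ k) => M.carrier ◁ T.unit) (fun {k} (M : Alg S₀ k) => D.unit_comm M)
    (fun {k} {M N : Alg S₀ k} (g : M ⟶ N) => (whisker_exchange (AlgHom.hom g) T.unit).symm)
    (fun {k k'} Q (M : Alg S₀ k) => by
      have h1 : (Q ≫ M.carrier) ◁ T.unit = eqToHom (Strict.assoc _ _ _) ≫
          Q ◁ M.carrier ◁ T.unit ≫ eqToHom (Strict.assoc _ _ _).symm := by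
        simp [Strict.associator_eqToIso]
      exact h1)

/-- The relative monad `T̂` on `I_*` given by a relative distributive law. -/
def algRelMonad : RelMonad (algInduced h) where
  T := D.algTrans
  ext :=
    { app := D.algExt
      index := D.algExt_index
      left := D.algExt_left
      right := D.algExt_right }
  unit := D.algUnit
  unit_left _ _ k := algMod_ext fun x => T.unit_left _ _ (algCell k x)
  unit_right := algMod_ext fun {k} (M : Alg S₀ k) =>
    (RightModule.self T).op_unit M.carrier
  assoc _ _ _ k l := algMod_ext fun x => T.assoc _ _ _ (algCell k x) (algCell l x)

/-- The lifting of `T` to the algebras given by a relative distributive law. -/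
def algLifting : AlgLifting T h where
  monad := D.algRelMonad
  forget_comm := rfl
  ext_induced {P} A C f {k} x := by
    let g : (algAt A x).carrier ≫ I ⟶ (algAt C x).carrier ≫ T.T := algCell f x
    have h1 : T.ext.app _ _ g = 𝟙 _ ≫ T.ext.app _ _ (g ≫ 𝟙 _) ≫ 𝟙 _ := by simp
    exact h1
  unit_induced {k} M := by
    have h1 : M.carrier ◁ T.unit = M.carrier ◁ T.unit ≫ 𝟙 _ := by simp
    exact h1

end RelDistLaw
end AlgebraLifting

/-! ### Free algebras and reindexing of structure maps -/

section FreeAlgebras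

variable {B : Type u} [Bicategory.{w, v} B] {a₀ a : B} {S₀ : Mnd a₀} {S : Mnd a}

/-- An algebra, with its carrier replaced by an equal 1-cell. -/
abbrev Alg.copy {k : B} (M : Alg S k) {c : k ⟶ a} (hc : M.carrier = c) : Alg S k where
  carrier := c
  str := eqToHom (by rw [hc]) ≫ M.str ≫ eqToHom hc
  unit := by subst hc; simpa using M.unit
  assoc := by subst hc; simpa using M.assoc

/-- A 2-cell into the carrier of a copy is an algebra morphism exactly when its transport into the
original carrier is. -/
theorem Alg.comm_copy_iff {k : B} (A M : Alg S k) {c : k ⟶ a} (hc : M.carrier = c)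
    (f : A.carrier ⟶ c) :
    A.str ≫ f ≫ eqToHom hc.symm = (f ≫ eqToHom hc.symm) ▷ S.S ≫ M.str ↔
      A.str ≫ f = f ▷ S.S ≫ (M.copy hc).str := by
  subst hc; simp

/-- The free algebra `(S, m)`, as a reducible definition; it is `freeAlg S`. -/
abbrev Alg.free (S : Mnd a) : Alg S a where
  carrier := S.S
  str := S.mul
  unit := S.unit_right
  assoc := by rw [S.assoc, Iso.inv_hom_id_assoc]

/-- The structure map of an algebra is a morphism from the free algebra on its carrier. -/
def Alg.counit {k : B} (M : Alg S k) : Alg.preObj M.carrier (Alg.free S) ⟶ M :=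
  (⟨M.str, by
    have h1 := M.assoc
    dsimp only
    rw [Category.assoc, h1]; simp⟩ : AlgHom _ _)

section Reindexing

variable {k k' : B}

/-- Reindexing along `P` of a 2-cell `S F M ⟶ F M`, for `F` after `M`. -/
abbrev reindexStr (P : k' ⟶ k) {M : k ⟶ a₀} {F : a₀ ⟶ a} (σ : (M ≫ F) ≫ S.S ⟶ M ≫ F) :
    ((P ≫ M) ≫ F) ≫ S.S ⟶ (P ≫ M) ≫ F :=
  (α_ P M F).hom ▷ S.S ≫ (α_ P (M ≫ F) S.S).hom ≫ P ◁ σ ≫ (α_ P M F).inv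

theorem Alg.inducedStr_pre {F : a₀ ⟶ a} (φ : F ≫ S.S ⟶ S₀.S ≫ F) (P : k' ⟶ k)
    (M : Alg S₀ k) : Alg.inducedStr φ (Alg.preObj P M) = reindexStr P (Alg.inducedStr φ M) := by
  simp [reindexStr]

variable {M N : k ⟶ a₀} {F G : a₀ ⟶ a} {σ : (M ≫ F) ≫ S.S ⟶ M ≫ F}
  {τ : (N ≫ G) ≫ S.S ⟶ N ≫ G} {f : M ≫ F ⟶ N ≫ G}

theorem reindexStr_comm (P : k' ⟶ k) (hf : σ ≫ f = f ▷ S.S ≫ τ) :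
    reindexStr P σ ≫ (α_ P M F).hom ≫ P ◁ f ≫ (α_ P N G).inv =
      ((α_ P M F).hom ≫ P ◁ f ≫ (α_ P N G).inv) ▷ S.S ≫ reindexStr P τ := by
  have h1 := congrArg (P ◁ ·) hf
  simp only [whiskerLeft_comp] at h1
  simp only [Category.assoc, Iso.inv_hom_id_assoc, comp_whiskerRight, reassoc_of% h1]
  rw [inv_hom_whiskerRight_assoc, associator_naturality_middle_assoc]

/-- Being a morphism of algebras can be checked after reindexing along the identity. -/
theorem comm_of_reindexStr_id
    (hf : reindexStr (𝟙 k) σ ≫ (α_ (𝟙 k) M F).hom ≫ 𝟙 k ◁ f ≫ (α_ (𝟙 k) N G).inv =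
      ((α_ (𝟙 k) M F).hom ≫ 𝟙 k ◁ f ≫ (α_ (𝟙 k) N G).inv) ▷ S.S ≫ reindexStr (𝟙 k) τ) :
    σ ≫ f = f ▷ S.S ≫ τ := by
  rw [← whiskerLeft_iff, whiskerLeft_comp, whiskerLeft_comp,
    ← cancel_mono (α_ (𝟙 k) N G).inv, ← cancel_epi (α_ (𝟙 k) (M ≫ F) S.S).hom,
    ← cancel_epi ((α_ (𝟙 k) M F).hom ▷ S.S)]
  simp only [Category.assoc, Iso.inv_hom_id_assoc, comp_whiskerRight] at hf ⊢
  rw [hf, inv_hom_whiskerRight_assoc, associator_naturality_middle_assoc]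

end Reindexing

/-- `φ` is recovered from the structure map it induces on the free algebra, by restriction along
the unit. -/
theorem free_inducedStr (F : a₀ ⟶ a) (φ : F ≫ S.S ⟶ S₀.S ≫ F) :
    ((λ_ F).inv ≫ S₀.unit ▷ F) ▷ S.S ≫ Alg.inducedStr φ (Alg.free S₀) = φ := by
  have h1 := congrArg (· ▷ F) S₀.unit_left
  simp only [comp_whiskerRight] at h1
  simp only [Alg.inducedStr, comp_whiskerRight, Category.assoc]
  rw [associator_naturality_left_assoc, ← whisker_exchange_assoc,
    associator_inv_naturality_left_assoc, h1]
  simp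

/-- The version of `free_inducedStr` for the free algebra on a 1-cell `A`. -/
theorem pre_free_inducedStr (F : a₀ ⟶ a) (φ : F ≫ S.S ⟶ S₀.S ≫ F) {k : B} (A : k ⟶ a₀) :
    (((ρ_ A).inv ≫ A ◁ S₀.unit) ▷ F) ▷ S.S ≫
      Alg.inducedStr φ (Alg.preObj A (Alg.free S₀)) =
        (α_ A F S.S).hom ≫ A ◁ φ ≫ (α_ A S₀.S F).inv := by
  have h1 := congrArg (A ◁ ·) (free_inducedStr F φ)
  simp only [whiskerLeft_comp] at h1
  rw [← h1]
  simp [Alg.inducedStr]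

/-- `Compatible.mul`, with the identification `S I = I S₀` read from right to left. -/
theorem Compatible.mul_symm {I : a₀ ⟶ a} (h : Compatible I S₀ S) :
    S₀.mul ▷ I ≫ eqToHom h.comm.symm = (α_ S₀.S S₀.S I).hom ≫ S₀.S ◁ eqToHom h.comm.symm ≫
      (α_ S₀.S I S.S).inv ≫ eqToHom h.comm.symm ▷ S.S ≫ (α_ I S.S S.S).hom ≫ I ◁ S.mul := by
  have h1 := h.mul
  rw [← cancel_mono (eqToHom h.comm)]
  simp only [Category.assoc, eqToHom_trans, eqToHom_refl, Category.comp_id]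
  rw [h1]
  simp

/-- `Compatible.unit`, with the identification `S I = I S₀` read from right to left. -/
theorem Compatible.unit_symm {I : a₀ ⟶ a} (h : Compatible I S₀ S) :
    S₀.unit ▷ I ≫ eqToHom h.comm.symm = (λ_ I).hom ≫ (ρ_ I).inv ≫ I ◁ S.unit := by
  have h1 := h.unit
  rw [← cancel_mono (eqToHom h.comm)]
  simp only [Category.assoc, eqToHom_trans, eqToHom_refl, Category.comp_id]
  rw [h1]
  simp

variable {I : a₀ ⟶ a} {T : RelMonad I} {h : Compatible I S₀ S}

/-- `d C · S f` is a morphism from the free algebra on `I A` to `T C` with the structure map given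
by `d`. -/
theorem distExt_comm {d : T.T ≫ S.S ⟶ S₀.S ≫ T.T}
    (hd : T.T ◁ S.mul ≫ d = (α_ T.T S.S S.S).inv ≫ d ▷ S.S ≫ (α_ S₀.S T.T S.S).hom ≫
      S₀.S ◁ d ≫ (α_ S₀.S S₀.S T.T).inv ≫ S₀.mul ▷ T.T)
    {o : B} (A C : o ⟶ a₀) (f : A ≫ I ⟶ C ≫ T.T) :
    ((α_ A S₀.S S₀.S).hom ≫ A ◁ S₀.mul) ▷ I ≫ distExt T h d A C f =
      distExt T h d (A ≫ S₀.S) (C ≫ S₀.S) (distExt T h d A C f) ≫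
        ((α_ C S₀.S S₀.S).hom ≫ C ◁ S₀.mul) ▷ T.T := by
  have h1 := congrArg (A ◁ ·) h.mul_symm
  have h2 := congrArg (C ◁ ·) hd
  simp only [whiskerLeft_comp] at h1 h2
  simp only [distExt, comp_whiskerRight, Category.assoc]
  rw [associator_naturality_middle_assoc, reassoc_of% h1,
    associator_inv_naturality_right_assoc, whisker_exchange_assoc,
    associator_naturality_right_assoc, reassoc_of% h2]
  generalize eqToHom h.comm.symm = ψ
  simp

/-- `d C · S f` extends `f` along the unit of the free algebra. -/
theorem unit_distExt {d : T.T ≫ S.S ⟶ S₀.S ≫ T.T}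
    (hd : T.T ◁ S.unit ≫ d = (ρ_ T.T).hom ≫ (λ_ T.T).inv ≫ S₀.unit ▷ T.T)
    {o : B} (A C : o ⟶ a₀) (f : A ≫ I ⟶ C ≫ T.T) :
    ((ρ_ A).inv ≫ A ◁ S₀.unit) ▷ I ≫ distExt T h d A C f =
      f ≫ ((ρ_ C).inv ≫ C ◁ S₀.unit) ▷ T.T := by
  have h1 := congrArg (A ◁ ·) h.unit_symm
  have h2 := congrArg (C ◁ ·) hd
  simp only [whiskerLeft_comp] at h1 h2
  simp only [distExt, comp_whiskerRight, Category.assoc]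
  rw [associator_naturality_middle_assoc, reassoc_of% h1,
    associator_inv_naturality_right_assoc, whisker_exchange_assoc,
    associator_naturality_right_assoc, reassoc_of% h2]
  simp

end FreeAlgebras

/-! ### Equality of functors, and the Yoneda embedding of an algebra -/

section Functors

variable {B : Type u} [Bicategory.{w, v} B] {a b : B} {C : Type u₁} [Category.{v₁} C]

theorem OneCell.functor_congr_hom {F G : C ⥤ OneCell.{r} a b} (e : F = G) {x y : C} (g : x ⟶ y) :
    TwoCell.hom (F.map g) = eqToHom (by rw [e]) ≫ TwoCell.hom (G.map g) ≫ eqToHom (by rw [e]) := by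
  subst e; simp

theorem Alg.functor_ext {S : Mnd a} {F G : C ⥤ Alg S b} (obj : ∀ x, F.obj x = G.obj x)
    (map : ∀ {x y : C} (g : x ⟶ y), AlgHom.hom (F.map g) = eqToHom (by rw [obj]) ≫
      AlgHom.hom (G.map g) ≫ eqToHom (by rw [obj])) : F = G :=
  CategoryTheory.Functor.ext obj fun x y g => by ext; simp [map]

end Functors

section YonedaEmbedding

variable {K : Type u} [Bicategory.{w, v} K] [Strict K] {X : K} {S : Mnd X}

variable {k : K} (M : Alg S k)

/-- The functor `P ↦ P^* M` of reindexings of an algebra `M`. -/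
abbrev Alg.yonedaMap (k' : K) : OneCell.{w} k' k ⥤ Alg S k' where
  obj P := Alg.preObj P.hom M
  map β := (Alg.preMap (TwoCell.hom β) S).app M
  map_id P := AlgHom.ext (by simp)
  map_comp β γ := AlgHom.ext (by simp)

theorem Alg.pre_yonedaMap {k' k'' : K} (P : k'' ⟶ k') :
    OneCell.pre P k ⋙ Alg.yonedaMap M k'' = Alg.yonedaMap M k' ⋙ Alg.pre P S :=
  CategoryTheory.Functor.ext
    (fun Q => ext_of (Strict.assoc _ _ _) (by
      simp [Strict.associator_eqToIso]))
    fun f g γ => by ext; simp [Strict.associator_eqToIso]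

theorem Alg.yonedaMap_map_preMap {k' k'' : K} {P P' : k'' ⟶ k'} (β : P ⟶ P')
    (Q : OneCell.{w} k' k) : (Alg.yonedaMap M k'').map ((OneCell.preMap β k).app Q) =
      eqToHom (congrArg (fun H => H.obj Q) (Alg.pre_yonedaMap M P)) ≫
        (Alg.preMap β S).app ((Alg.yonedaMap M k').obj Q) ≫
          eqToHom (congrArg (fun H => H.obj Q) (Alg.pre_yonedaMap M P')).symm := by
  ext; simp [Strict.associator_eqToIso]

/-- The 2-natural transformation `K(-, k) ⟶ S-Alg(-)`, `P ↦ P^* M`, corresponding to a `k`-indexed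
algebra `M` under the Yoneda lemma. -/
def Alg.yoneda : homTo.{w} k ⟶ algFunctor S :=
  mkCatTrans (fun k' => Alg.yonedaMap M k'.unop) (fun P => Alg.pre_yonedaMap M P.unop)
    (fun β Q => Alg.yonedaMap_map_preMap M β.unop2 Q)

end YonedaEmbedding

/-! ### The distributive law of a lifting to algebras -/

section LiftingStructure

variable {K : Type u} [Bicategory.{w, v} K] [Strict K] {X₀ X : K} {I : X₀ ⟶ X}
  {S₀ : Mnd X₀} {S : Mnd X} {T : RelMonad I} {h : Compatible I S₀ S}

namespace AlgLifting

/-- A lifting is determined by its underlying 2-natural transformation, since its extension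
operator and its unit have prescribed underlying 2-cells. -/
theorem ext_monad {L L' : AlgLifting T h} (hL : L.monad.T = L'.monad.T) : L = L' := by
  obtain ⟨⟨U, ⟨e, _, _, _⟩, u, _, _, _⟩, c, he, hu⟩ := L
  obtain ⟨⟨U', ⟨e', _, _, _⟩, u', _, _, _⟩, c', he', hu'⟩ := L'
  obtain rfl : U = U' := hL
  obtain rfl : @e = @e' := by
    funext P A C f
    exact algMod_ext fun x => (he A C f x).trans (he' A C f x).symm
  obtain rfl : u = u' := algMod_ext fun x => (hu x).trans (hu' x).symm
  rfl

variable (L : AlgLifting T h)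

theorem carrier_eq {k : K} (M : Alg S₀ k) : (algAt L.monad.T M).carrier = M.carrier ≫ T.T :=
  algAt_carrier L.forget_comm M

/-- The algebra `T̂(M, m)`, with carrier `T M` on the nose. -/
abbrev obj {k : K} (M : Alg S₀ k) : Alg S k := (algAt L.monad.T M).copy (L.carrier_eq M)

/-- The structure map `S T M ⟶ T M` of `T̂(M, m)`. -/
def str {k : K} (M : Alg S₀ k) : (M.carrier ≫ T.T) ≫ S.S ⟶ M.carrier ≫ T.T := (L.obj M).str

theorem unit_str {k : K} (M : Alg S₀ k) :
    (M.carrier ≫ T.T) ◁ S.unit ≫ L.str M = (ρ_ (M.carrier ≫ T.T)).hom :=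
  (L.obj M).unit

theorem mul_str {k : K} (M : Alg S₀ k) : (M.carrier ≫ T.T) ◁ S.mul ≫ L.str M =
    (α_ (M.carrier ≫ T.T) S.S S.S).inv ≫ L.str M ▷ S.S ≫ L.str M :=
  (L.obj M).assoc

theorem comm_iff {k : K} (A : Alg S k) (M : Alg S₀ k) (f : A.carrier ⟶ M.carrier ≫ T.T) :
    A.str ≫ f ≫ eqToHom (L.carrier_eq M).symm =
        (f ≫ eqToHom (L.carrier_eq M).symm) ▷ S.S ≫ (algAt L.monad.T M).str ↔
      A.str ≫ f = f ▷ S.S ≫ L.str M :=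
  Alg.comm_copy_iff A _ _ f

/-- On morphisms, a lifting is whiskering with `T`, up to the identification of carriers. -/
theorem mapCell {k : K} {M N : Alg S₀ k} (g : M ⟶ N) :
    algMapCell L.monad.T (k := k) (x := M) (y := N) g =
      eqToHom (L.carrier_eq M) ≫ AlgHom.hom g ▷ T.T ≫ eqToHom (L.carrier_eq N).symm := by
  have h1 := congrArg (fun F : algFunctor S₀ ⟶ homTo.{w} X => (TwoNatTrans.app F (op k)).toFunctor)
    L.forget_comm
  exact OneCell.functor_congr_hom (C := Alg S₀ k) h1 g

theorem str_map {k : K} {M N : Alg S₀ k} (g : M ⟶ N) :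
    L.str M ≫ AlgHom.hom g ▷ T.T = (AlgHom.hom g ▷ T.T) ▷ S.S ≫ L.str N := by
  have h1 := AlgHom.comm ((TwoNatTrans.app L.monad.T (op k)).toFunctor.map (X := M) (Y := N) g)
  have h2 : (algAt L.monad.T M).str ≫ algMapCell L.monad.T (k := k) (x := M) (y := N) g =
    algMapCell L.monad.T (k := k) (x := M) (y := N) g ▷ S.S ≫ (algAt L.monad.T N).str := h1
  rw [L.mapCell] at h2
  rw [← cancel_mono (eqToHom (L.carrier_eq N).symm),
    ← cancel_epi (eqToHom (congrArg (· ≫ S.S) (L.carrier_eq M)))]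
  simpa [str] using h2

/-- A lifting is determined by its structure maps `S T M ⟶ T M`. -/
theorem ext_str {L L' : AlgLifting T h} (hL : ∀ {k : K} (M : Alg S₀ k),
    L.str M = L'.str M) : L = L' := by
  refine ext_monad (TwoNatTrans.ext (funext fun k => Cat.ext ?_))
  refine Alg.functor_ext (C := Alg S₀ k.unop) (fun M => ?_) (fun {M N} g => ?_)
  · refine Alg.ext_of ((L.carrier_eq (k := k.unop) M).trans
      (L'.carrier_eq (k := k.unop) M).symm) ?_
    have h1 := hL (k := k.unop) M
    dsimp only [str] at h1
    rw [eqToHom_comp_iff, comp_eqToHom_iff] at h1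
    refine h1.trans ?_
    simp
  · refine (L.mapCell (k := k.unop) (M := M) (N := N) g).trans ?_
    have h1 := L'.mapCell (k := k.unop) (M := M) (N := N) g
    have h2 : eqToHom (L.carrier_eq (k := k.unop) M) ≫ AlgHom.hom g ▷ T.T ≫
        eqToHom (L.carrier_eq (k := k.unop) N).symm =
        eqToHom ((L.carrier_eq (k := k.unop) M).trans (L'.carrier_eq (k := k.unop) M).symm) ≫
          algMapCell L'.monad.T (k := k.unop) (x := M) (y := N) g ≫
          eqToHom ((L'.carrier_eq (k := k.unop) N).trans
            (L.carrier_eq (k := k.unop) N).symm) := by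
      rw [h1]; simp
    exact h2

theorem str_reindex {k k' : K} (P : k' ⟶ k) (M : Alg S₀ k) :
    L.str (Alg.preObj P M) = reindexStr P (L.str M) := by
  have h1 : algAt L.monad.T (Alg.preObj P M) = Alg.preObj P (algAt L.monad.T M) :=
    algAt_reindex L.monad.T P M
  have h2 : ∀ {A A' : Alg S k'} (e : A = A'), A.str = eqToHom (by rw [e]) ≫ A'.str ≫
      eqToHom (by rw [e]) := by
    rintro A _ rfl; simp
  dsimp only [str]
  rw [h2 h1]
  simp [reindexStr, Strict.associator_eqToIso]

/-- The unit of a lifting being an algebra morphism `I M ⟶ T̂ M`. -/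
theorem str_relUnit {k : K} (M : Alg S₀ k) :
    Alg.inducedStr (eqToHom h.comm) M ≫ M.carrier ◁ T.unit =
      (M.carrier ◁ T.unit) ▷ S.S ≫ L.str M := by
  refine (L.comm_iff (Alg.inducedObj h M) M _).1 ?_
  have h1 : (Alg.inducedObj h M).str ≫ algCell L.monad.unit M =
      algCell L.monad.unit M ▷ S.S ≫ (algAt L.monad.T M).str :=
    AlgHom.comm ((TwoMod.app L.monad.unit (op k)).toNatTrans.app M)
  have h2 : algCell L.monad.unit M = M.carrier ◁ T.unit ≫ eqToHom (L.carrier_eq M).symm :=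
    L.unit_induced M
  rw [h2] at h1
  exact h1

/-- An algebra morphism `I M ⟶ T̂ N`, as a modification between the corresponding
2-natural transformations out of a representable. -/
def yonedaMod {k : K} {M N : Alg S₀ k} (f : M.carrier ≫ I ⟶ N.carrier ≫ T.T)
    (hf : Alg.inducedStr (eqToHom h.comm) M ≫ f = f ▷ S.S ≫ L.str N) :
    Alg.yoneda M ≫ algInduced h ⟶ Alg.yoneda N ≫ L.monad.T :=
  mkAlgMod
    (fun {k'} (P : OneCell.{w} k' k) =>
      ((α_ P.hom M.carrier I).hom ≫ P.hom ◁ f ≫ (α_ P.hom N.carrier T.T).inv) ≫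
        eqToHom (L.carrier_eq (Alg.preObj P.hom N)).symm)
    (fun {k'} (P : OneCell.{w} k' k) => by
      refine (L.comm_iff (Alg.inducedObj h (Alg.preObj P.hom M)) (Alg.preObj P.hom N) _).2 ?_
      rw [L.str_reindex]
      exact (congrArg (· ≫ _) (Alg.inducedStr_pre (eqToHom h.comm) P.hom M)).trans
        (reindexStr_comm P.hom hf))
    (fun {k'} {P P' : OneCell.{w} k' k} (β : P ⟶ P') => by
      have h1 := L.mapCell ((Alg.yonedaMap N k').map β)
      have h2 : (TwoCell.hom β ▷ M.carrier) ▷ I ≫ ((α_ P'.hom M.carrier I).hom ≫ P'.hom ◁ f ≫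
          (α_ P'.hom N.carrier T.T).inv) ≫ eqToHom (L.carrier_eq (Alg.preObj P'.hom N)).symm =
          (((α_ P.hom M.carrier I).hom ≫ P.hom ◁ f ≫
          (α_ P.hom N.carrier T.T).inv) ≫ eqToHom (L.carrier_eq (Alg.preObj P.hom N)).symm) ≫
          eqToHom (L.carrier_eq (Alg.preObj P.hom N)) ≫ (TwoCell.hom β ▷ N.carrier) ▷ T.T ≫
          eqToHom (L.carrier_eq (Alg.preObj P'.hom N)).symm := by
        simp only [Category.assoc, eqToHom_trans_assoc, eqToHom_refl, Category.id_comp]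
        rw [associator_naturality_left_assoc, ← whisker_exchange_assoc,
          associator_inv_naturality_left_assoc]
      exact h2.trans (congrArg (_ ≫ ·) h1.symm))
    (fun {k' k''} Q (P : OneCell.{w} k' k) => by
      have h1 : ∀ (q : (algAt L.monad.T (Alg.preObj (Q ≫ P.hom) N)).carrier =
          Q ≫ (algAt L.monad.T (Alg.preObj P.hom N)).carrier),
        ((α_ (Q ≫ P.hom) M.carrier I).hom ≫ (Q ≫ P.hom) ◁ f ≫
          (α_ (Q ≫ P.hom) N.carrier T.T).inv) ≫
            eqToHom (L.carrier_eq (Alg.preObj (Q ≫ P.hom) N)).symm =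
        eqToHom (by simp) ≫ Q ◁ (((α_ P.hom M.carrier I).hom ≫ P.hom ◁ f ≫
          (α_ P.hom N.carrier T.T).inv) ≫ eqToHom (L.carrier_eq (Alg.preObj P.hom N)).symm) ≫
          eqToHom q.symm := by
        intro q
        simp [Strict.associator_eqToIso]
      exact h1 (algAt_reindex_carrier (Alg.yoneda N ≫ L.monad.T) Q P))

/-- The extension of an algebra morphism `I M ⟶ T̂ N` is an algebra morphism `T̂ M ⟶ T̂ N`: it is
the component at the identity of the extension of `yonedaMod`. -/
theorem str_ext {k : K} {M N : Alg S₀ k} (f : M.carrier ≫ I ⟶ N.carrier ≫ T.T)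
    (hf : Alg.inducedStr (eqToHom h.comm) M ≫ f = f ▷ S.S ≫ L.str N) :
    L.str M ≫ T.ext.app M.carrier N.carrier f =
      T.ext.app M.carrier N.carrier f ▷ S.S ≫ L.str N := by
  -- Evaluating at `𝟙 k` yields the reindexed algebras `(𝟙 k)^* M` and `(𝟙 k)^* N`.
  let Γ := L.monad.ext.app (Alg.yoneda M) (Alg.yoneda N) (L.yonedaMod f hf)
  let x : OneCell.{w} k k := ⟨𝟙 k⟩
  let M' := Alg.preObj (𝟙 k) M
  let N' := Alg.preObj (𝟙 k) N
  let c : (algAt L.monad.T M').carrier ⟶ (algAt L.monad.T N').carrier := algCell Γ x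
  have h1 : (algAt L.monad.T M').str ≫ c = c ▷ S.S ≫ (algAt L.monad.T N').str :=
    AlgHom.comm ((TwoMod.app Γ (op k)).toNatTrans.app x)
  have h2 : c = eqToHom (L.carrier_eq M') ≫
      T.ext.app M'.carrier N'.carrier
        ((((α_ (𝟙 k) M.carrier I).hom ≫ 𝟙 k ◁ f ≫ (α_ (𝟙 k) N.carrier T.T).inv) ≫
        eqToHom (L.carrier_eq N').symm) ≫ eqToHom (L.carrier_eq N')) ≫
      eqToHom (L.carrier_eq N').symm := L.ext_induced _ _ _ _
  have h3 : c = eqToHom (L.carrier_eq M') ≫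
      ((α_ (𝟙 k) M.carrier T.T).hom ≫ 𝟙 k ◁ T.ext.app _ _ f ≫
        (α_ (𝟙 k) N.carrier T.T).inv) ≫ eqToHom (L.carrier_eq N').symm := by
    rw [← T.ext.index, h2]
    simp only [Category.assoc, eqToHom_trans, eqToHom_refl, Category.comp_id]
    rfl
  rw [h3] at h1
  refine comm_of_reindexStr_id ?_
  rw [← L.str_reindex, ← L.str_reindex, ← cancel_mono (eqToHom (L.carrier_eq N').symm),
      ← cancel_epi (eqToHom (congrArg (· ≫ S.S) (L.carrier_eq M')))]
  generalize (α_ (𝟙 k) M.carrier T.T).hom ≫ 𝟙 k ◁ T.ext.app _ _ f ≫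
        (α_ (𝟙 k) N.carrier T.T).inv = z at h1 ⊢
  simpa [str] using h1

/-- The 2-cell `S T ⟶ S T S₀ ⟶ T S₀`, the second map being the structure map of
`T̂(S₀, m₀)`. -/
def dist : T.T ≫ S.S ⟶ S₀.S ≫ T.T :=
  ((λ_ T.T).inv ≫ S₀.unit ▷ T.T) ▷ S.S ≫ L.str (Alg.free S₀)

/-- Every structure map is `T m · d M`, as `m` is a morphism of algebras from the free algebra
on `M`. -/
theorem str_eq {k : K} (M : Alg S₀ k) : L.str M = Alg.inducedStr L.dist M := by
  have h1 : L.str (Alg.preObj M.carrier (Alg.free S₀)) ≫ M.str ▷ T.T =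
      (M.str ▷ T.T) ▷ S.S ≫ L.str M := L.str_map (Alg.counit M)
  have h2 : ((ρ_ M.carrier).inv ≫ M.carrier ◁ S₀.unit) ≫ M.str = 𝟙 _ := by
    rw [Category.assoc, M.unit, Iso.inv_hom_id]
  have h3 := congrArg (fun z => (z ▷ T.T) ▷ S.S) h2
  simp only [comp_whiskerRight, id_whiskerRight] at h3
  rw [L.str_reindex, reindexStr] at h1
  rw [← Category.id_comp (L.str M), ← h3]
  simp only [Category.assoc] at h1 ⊢
  rw [← h1]
  simp only [Alg.inducedStr, dist]
  bicategory

theorem dist_unit : T.T ◁ S.unit ≫ L.dist = (ρ_ T.T).hom ≫ (λ_ T.T).inv ≫ S₀.unit ▷ T.T := by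
  rw [dist, whisker_exchange_assoc, L.unit_str (Alg.free S₀)]
  simp

theorem dist_mul : T.T ◁ S.mul ≫ L.dist = (α_ T.T S.S S.S).inv ≫ L.dist ▷ S.S ≫
    (α_ S₀.S T.T S.S).hom ≫ S₀.S ◁ L.dist ≫ (α_ S₀.S S₀.S T.T).inv ≫ S₀.mul ▷ T.T := by
  have h1 : S₀.S ◁ L.dist ≫ (α_ S₀.S S₀.S T.T).inv ≫ S₀.mul ▷ T.T =
      (α_ S₀.S T.T S.S).inv ≫ L.str (Alg.free S₀) := by
    rw [L.str_eq]; simp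
  rw [h1]
  conv_lhs => rw [dist, whisker_exchange_assoc, L.mul_str (Alg.free S₀)]
  simp [dist]

/-- The relative distributive law of a lifting. -/
def distLaw : RelDistLaw T h where
  d := L.dist
  unit := L.dist_unit
  mul := L.dist_mul
  extension A C f := by
    -- `d C · S f` is an algebra morphism from the free algebra on `I A` to `T̂` of the
    -- free algebra on `C`, so that its extension is one as well; restricting along the units gives
    -- the axiom for `f`.
    have h1 := distExt_comm (h := h) L.dist_mul A C f
    have h2 := unit_distExt (h := h) L.dist_unit A C f
    let M := Alg.preObj A (Alg.free S₀)
    let N := Alg.preObj C (Alg.free S₀)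
    have h3 := (inducedStr_comm_iff (h := h) L.dist M N (distExt T h L.dist A C f)).2 h1
    rw [← L.str_eq] at h3
    have h4 := L.str_ext (M := M) (N := N) _ h3
    rw [L.str_eq, L.str_eq] at h4
    have h5 : ((ρ_ A).inv ≫ A ◁ S₀.unit) ▷ T.T ≫
        T.ext.app (A ≫ S₀.S) (C ≫ S₀.S) (distExt T h L.dist A C f) =
        T.ext.app A C f ≫ ((ρ_ C).inv ≫ C ◁ S₀.unit) ▷ T.T := by
      rw [← T.ext.left, h2, T.ext.right]
    have h6 := congrArg (· ▷ S.S) h5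
    simp only [comp_whiskerRight _ _ S.S] at h6
    have h7 := pre_free_inducedStr T.T L.dist A
    have h8 := pre_free_inducedStr T.T L.dist C
    rw [← h8, ← reassoc_of% h6, ← h4, ← Category.assoc (_ ▷ S.S), h7]
    simp only [Category.assoc]
    rfl
  relUnit := by
    have h1 := L.str_relUnit (Alg.free S₀)
    have h2 := free_inducedStr I (eqToHom h.comm)
    have h3 : T.unit ▷ S.S ≫ ((λ_ T.T).inv ≫ S₀.unit ▷ T.T) ▷ S.S =
        ((λ_ I).inv ≫ S₀.unit ▷ I) ▷ S.S ≫ (S₀.S ◁ T.unit) ▷ S.S := by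
      simp only [← comp_whiskerRight, Category.assoc, ← whisker_exchange]
      simp
    have h4 : T.unit ▷ S.S ≫ L.dist = (T.unit ▷ S.S ≫ ((λ_ T.T).inv ≫ S₀.unit ▷ T.T) ▷ S.S) ≫
        L.str (Alg.free S₀) :=
      (Category.assoc _ _ _).symm
    rw [h4, h3]
    refine (Category.assoc _ _ _).trans ?_
    refine (congrArg (_ ≫ ·) h1.symm).trans ?_
    rw [← Category.assoc]
    exact congrArg (· ≫ _) h2

end AlgLifting

theorem RelDistLaw.algLifting_str_eq (D : RelDistLaw T h) {k : K} (M : Alg S₀ k) :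
    D.algLifting.str M = Alg.inducedStr D.d M := by
  have h1 : 𝟙 _ ≫ Alg.inducedStr D.d M ≫ 𝟙 _ = Alg.inducedStr D.d M := by simp
  exact h1

/-- Relative distributive laws are equivalent to liftings to the algebras. -/
def algEquiv (T : RelMonad I) (h : Compatible I S₀ S) : RelDistLaw T h ≃ AlgLifting T h where
  toFun D := D.algLifting
  invFun L := L.distLaw
  left_inv D := by
    refine RelDistLaw.ext_d ?_
    refine (congrArg (_ ≫ ·) (D.algLifting_str_eq (Alg.free S₀))).trans ?_
    exact free_inducedStr T.T D.d
  right_inv L := AlgLifting.ext_str fun M =>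
    (L.distLaw.algLifting_str_eq M).trans (L.str_eq M).symm

end LiftingStructure

/-! ### The right modules `M S₀` -/

section Modules

variable {B : Type u} [Bicategory.{w, v} B] {a₀ a : B} {I : a₀ ⟶ a} {S₀ : Mnd a₀} {S : Mnd a}
  {T : RelMonad I} {h : Compatible I S₀ S}

theorem distExt_index (d : T.T ≫ S.S ⟶ S₀.S ≫ T.T) {o o' : B} (P : o' ⟶ o) (A C : o ⟶ a₀)
    (f : A ≫ I ⟶ C ≫ T.T) :
    distExt T h d (P ≫ A) (P ≫ C) ((α_ P A I).hom ≫ P ◁ f ≫ (α_ P C T.T).inv) =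
      (α_ P A S₀.S).hom ▷ I ≫ ((α_ P (A ≫ S₀.S) I).hom ≫ P ◁ distExt T h d A C f ≫
        (α_ P (C ≫ S₀.S) T.T).inv) ≫ (α_ P C S₀.S).inv ▷ T.T := by
  simp only [distExt]
  generalize eqToHom h.comm.symm = ψ
  simp

theorem distExt_left (d : T.T ≫ S.S ⟶ S₀.S ≫ T.T) {o : B} {A A' : o ⟶ a₀} (C : o ⟶ a₀)
    (γ : A' ⟶ A) (f : A ≫ I ⟶ C ≫ T.T) :
    distExt T h d A' C (γ ▷ I ≫ f) = (γ ▷ S₀.S) ▷ I ≫ distExt T h d A C f := by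
  simp only [distExt, comp_whiskerRight, Category.assoc]
  rw [associator_naturality_left_assoc, ← whisker_exchange_assoc,
    associator_inv_naturality_left_assoc]

theorem distExt_right (d : T.T ≫ S.S ⟶ S₀.S ≫ T.T) {o : B} (A : o ⟶ a₀) {C C' : o ⟶ a₀}
    (f : A ≫ I ⟶ C ≫ T.T) (γ : C ⟶ C') :
    distExt T h d A C' (f ≫ γ ▷ T.T) = distExt T h d A C f ≫ (γ ▷ S₀.S) ▷ T.T := by
  simp only [distExt, comp_whiskerRight, Category.assoc]
  rw [associator_naturality_left_assoc, ← whisker_exchange_assoc,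
    associator_inv_naturality_left]

namespace RelDistLaw

variable (D : RelDistLaw T h)

theorem distExt_unit {o : B} (A : o ⟶ a₀) :
    distExt T h D.d A A (A ◁ T.unit) = (A ≫ S₀.S) ◁ T.unit := by
  have h1 := congrArg (A ◁ ·) D.relUnit
  simp only [whiskerLeft_comp] at h1
  simp only [distExt]
  rw [associator_naturality_middle_assoc, reassoc_of% h1]
  simp

/-- The extension axiom of `d`, as compatibility of `f ↦ d · S f` with Kleisli composition. -/
theorem distExt_ext {o : B} (A C E : o ⟶ a₀) (f : A ≫ I ⟶ C ≫ T.T) (g : C ≫ I ⟶ E ≫ T.T) :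
    distExt T h D.d A E (f ≫ T.ext.app C E g) =
      distExt T h D.d A C f ≫ T.ext.app (C ≫ S₀.S) (E ≫ S₀.S) (distExt T h D.d C E g) := by
  have h1 := D.extension C E g
  conv_lhs => rw [distExt, comp_whiskerRight, Category.assoc, ← h1]
  simp only [distExt, Category.assoc]

/-- The module `(M S₀, f ↦ (d · S f)_m)`. -/
abbrev modObj {k : B} (M : RightModule T k) : RightModule T k where
  carrier := S₀.S ≫ M.carrier
  op :=
    { app := fun A C f => (α_ A S₀.S M.carrier).inv ≫
        M.op.app (A ≫ S₀.S) (C ≫ S₀.S) (distExt T h D.d A C f) ≫ (α_ C S₀.S M.carrier).hom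
      index := fun P A C f => by
        rw [distExt_index, M.op.left, M.op.right, M.op.index]; simp
      left := fun C γ f => by rw [distExt_left, M.op.left]; simp
      right := fun A _ _ f γ => by rw [distExt_right, M.op.right]; simp }
  unit := by dsimp only; rw [distExt_unit, M.op_unit]; simp
  assoc A C E f g := by dsimp only; rw [distExt_ext, M.assoc]; simp

/-- The functor `(M, (-)_m) ↦ (M S₀, f ↦ (d · S f)_m)`. -/
abbrev modMap (k : B) : RightModule T k ⥤ RightModule T k where
  obj M := D.modObj M
  map g :=
    { hom := S₀.S ◁ RightModuleHom.hom g
      comm := fun A C f => by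
        have h1 := RightModuleHom.comm g _ _ (distExt T h D.d A C f)
        simp only [comp_whiskerLeft] at h1
        simp only [Category.assoc]
        rw [← cancel_mono (α_ C S₀.S _).inv]
        simp only [Category.assoc, h1, Iso.hom_inv_id, Category.comp_id]
        simp }

/-- `M m₀` is a module morphism, as `d · S f` is a morphism out of a free algebra. -/
theorem modMul_comm {k : B} (M : RightModule T k) {o : B} (A C : o ⟶ a₀)
    (f : A ≫ I ⟶ C ≫ T.T) :
    (D.modObj (D.modObj M)).op.app A C f ≫ C ◁ ((α_ S₀.S S₀.S M.carrier).inv ≫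
        S₀.mul ▷ M.carrier) =
      A ◁ ((α_ S₀.S S₀.S M.carrier).inv ≫ S₀.mul ▷ M.carrier) ≫
        (D.modObj M).op.app A C f := by
  have h1 := congrArg (M.op.app _ _) (distExt_comm (h := h) D.mul A C f)
  rw [M.op.left, M.op.right] at h1
  have h2 : (A ◁ S₀.mul) ▷ M.carrier ≫ M.op.app (A ≫ S₀.S) (C ≫ S₀.S) (distExt T h D.d A C f) =
      (α_ A S₀.S S₀.S).inv ▷ M.carrier ≫ M.op.app _ _ (distExt T h D.d _ _
        (distExt T h D.d A C f)) ≫ ((α_ C S₀.S S₀.S).hom ≫ C ◁ S₀.mul) ▷ M.carrier := by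
    rw [← h1]; simp
  simp only [whiskerLeft_comp, Category.assoc]
  rw [associator_inv_naturality_middle_assoc, reassoc_of% h2]
  generalize M.op.app _ _ (distExt T h D.d _ _ (distExt T h D.d A C f)) = z
  bicategory

/-- `M s₀` is a module morphism, as `d · S f` extends `f` along the unit. -/
theorem modUnit_comm {k : B} (M : RightModule T k) {o : B} (A C : o ⟶ a₀)
    (f : A ≫ I ⟶ C ≫ T.T) :
    M.op.app A C f ≫ C ◁ ((λ_ M.carrier).inv ≫ S₀.unit ▷ M.carrier) =
      A ◁ ((λ_ M.carrier).inv ≫ S₀.unit ▷ M.carrier) ≫ (D.modObj M).op.app A C f := by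
  have h1 := congrArg (M.op.app _ _) (unit_distExt (h := h) D.unit A C f)
  rw [M.op.left, M.op.right] at h1
  have h2 : (A ◁ S₀.unit) ▷ M.carrier ≫
      M.op.app (A ≫ S₀.S) (C ≫ S₀.S) (distExt T h D.d A C f) =
      (ρ_ A).hom ▷ M.carrier ≫ M.op.app A C f ≫
        ((ρ_ C).inv ≫ C ◁ S₀.unit) ▷ M.carrier := by
    rw [← h1, comp_whiskerRight, Category.assoc, hom_inv_whiskerRight_assoc]
  simp only [whiskerLeft_comp, Category.assoc]
  rw [associator_inv_naturality_middle_assoc, reassoc_of% h2]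
  generalize M.op.app A C f = z
  bicategory

/-- `N d` is a module morphism: this is the extension axiom of `d`, whiskered with `N`. -/
theorem dstar_comm {k : B} (N : a ⟶ k) {o : B} (A C : o ⟶ a₀)
    (f : A ≫ I ⟶ C ≫ T.T) :
    (RightModule.postObj (S.S ≫ N) (RightModule.self T)).op.app A C f ≫
        C ◁ ((α_ T.T S.S N).inv ≫ D.d ▷ N ≫ (α_ S₀.S T.T N).hom) =
      A ◁ ((α_ T.T S.S N).inv ≫ D.d ▷ N ≫ (α_ S₀.S T.T N).hom) ≫
        (D.modObj (RightModule.postObj N (RightModule.self T))).op.app A C f := by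
  have h1 : (A ◁ D.d) ▷ N ≫ (α_ A S₀.S T.T).inv ▷ N ≫
      T.ext.app (A ≫ S₀.S) (C ≫ S₀.S) (distExt T h D.d A C f) ▷ N =
        (α_ A T.T S.S).inv ▷ N ≫ (T.ext.app A C f ▷ S.S) ▷ N ≫ (α_ C T.T S.S).hom ▷ N ≫
          (C ◁ D.d) ▷ N ≫ (α_ C S₀.S T.T).inv ▷ N := by
    have h2 := D.extension A C f
    rw [← Iso.eq_inv_comp] at h2
    simp only [← comp_whiskerRight, h2]
  trans A ◁ (α_ T.T S.S N).inv ≫ (α_ A (T.T ≫ S.S) N).inv ≫ ((A ◁ D.d) ▷ N ≫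
    (α_ A S₀.S T.T).inv ▷ N ≫
      T.ext.app (A ≫ S₀.S) (C ≫ S₀.S) (distExt T h D.d A C f) ▷ N) ≫
        (α_ (C ≫ S₀.S) T.T N).hom ≫ (α_ C S₀.S (T.T ≫ N)).hom
  · rw [h1]
    dsimp only
    generalize T.ext.app A C f = z
    bicategory
  · dsimp only
    generalize T.ext.app _ _ (distExt T h D.d A C f) = z
    bicategory

end RelDistLaw

end Modules

/-! ### Modifications into the 2-functors of modules and of 1-cells -/

section ModuleModifications

variable {K : Type u} [Bicategory.{w, v} K] [Strict K] {X₀ X : K} {I : X₀ ⟶ X}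
  {T : RelMonad I} {P : StrictPseudofunctor K Cat.{w, max u v w}}

/-- The 2-cell underlying the action of `A_k` on a morphism. -/
abbrev modMapCell (A : P ⟶ modFunctor T) {k : K} {x y : P.obj k} (g : x ⟶ y) :
    (modAt A x).carrier ⟶ (modAt A y).carrier :=
  RightModuleHom.hom ((TwoNatTrans.app A k).toFunctor.map g)

theorem modAt_post (A : P ⟶ modFunctor T) {k k' : K} (Q : k ⟶ k') (x : P.obj k) :
    modAt A ((P.map Q).toFunctor.obj x) = RightModule.postObj Q (modAt A x) :=
  congrArg (fun H => H.toFunctor.obj x) (TwoNatTrans.naturality A Q)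

theorem modAt_post_carrier (A : P ⟶ modFunctor T) {k k' : K} (Q : k ⟶ k')
    (x : P.obj k) :
    (modAt A ((P.map Q).toFunctor.obj x)).carrier = (modAt A x).carrier ≫ Q :=
  congrArg RightModule.carrier (modAt_post A Q x)

/-- The modification axiom, on underlying 2-cells. -/
theorem modCell_post {A A' : P ⟶ modFunctor T} (Γ : A ⟶ A') {k k' : K} (Q : k ⟶ k')
    (x : P.obj k) :
    modCell Γ ((P.map Q).toFunctor.obj x) =
      eqToHom (modAt_post_carrier A Q x) ≫ modCell Γ x ▷ Q ≫
        eqToHom (modAt_post_carrier A' Q x).symm := by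
  have h1 := congrArg (fun z => (z.toNatTrans.app x)) (TwoMod.naturality Γ Q)
  simp only [Cat.Hom₂.comp_app, Cat.eqToHom_app] at h1
  have h2 := congrArg RightModuleHom.hom h1
  have h3 : modCell Γ ((P.map Q).toFunctor.obj x) ≫
      eqToHom (modAt_post_carrier A' Q x) =
      eqToHom (modAt_post_carrier A Q x) ≫ modCell Γ x ▷ Q := by
    rw [← RightModule.eqToHom_hom (modAt_post A Q x),
      ← RightModule.eqToHom_hom (modAt_post A' Q x)]
    exact h2
  rw [← Category.assoc, ← h3]; simp

theorem modMod_ext {A A' : P ⟶ modFunctor T} {Γ Γ' : A ⟶ A'}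
    (e : ∀ {k : K} (x : P.obj k), modCell Γ x = modCell Γ' x) : Γ = Γ' :=
  TwoMod.ext (funext fun _ => Cat.Hom₂.ext (NatTrans.ext (funext fun x =>
    RightModuleHom.ext (e x))))

/-- A modification into `Mod_T(-)`, from its underlying 2-cells. -/
def mkModMod {A A' : P ⟶ modFunctor T}
    (c : ∀ {k : K} (x : P.obj k), (modAt A x).carrier ⟶ (modAt A' x).carrier)
    (comm : ∀ {k : K} (x : P.obj k) {o : K} (E F : o ⟶ X₀) (f : E ≫ I ⟶ F ≫ T.T),
      (modAt A x).op.app E F f ≫ F ◁ c x = E ◁ c x ≫ (modAt A' x).op.app E F f)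
    (naturality : ∀ {k : K} {x y : P.obj k} (g : x ⟶ y),
      modMapCell A g ≫ c y = c x ≫ modMapCell A' g)
    (post : ∀ {k k' : K} (Q : k ⟶ k') (x : P.obj k),
      c ((P.map Q).toFunctor.obj x) = eqToHom (modAt_post_carrier A Q x) ≫ c x ▷ Q ≫
        eqToHom (modAt_post_carrier A' Q x).symm) : A ⟶ A' :=
  mkCatMod (fun k =>
    { app := fun x => (⟨c x, comm x⟩ : RightModuleHom (modAt A x) (modAt A' x))
      naturality := fun x y g => RightModuleHom.ext (naturality g) })
    (fun {k k'} Q x => RightModuleHom.ext (by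
      have h1 : c ((P.map Q).toFunctor.obj x) ≫
          eqToHom (modAt_post_carrier A' Q x) =
          eqToHom (modAt_post_carrier A Q x) ≫ c x ▷ Q := by
        refine (congrArg (· ≫ _) (post Q x)).trans ?_
        simp
      rw [← RightModule.eqToHom_hom (modAt_post A Q x),
        ← RightModule.eqToHom_hom (modAt_post A' Q x)] at h1
      exact h1))

section HomFrom

variable {x : K} {A A' : P ⟶ homFrom.{max u w} x}

/-- The 2-cell underlying the component at `y` of a modification into `K(x, -)`. -/
abbrev homCell (Γ : A ⟶ A') {k : K} (y : P.obj k) :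
    OneCell.hom ((TwoNatTrans.app A k).toFunctor.obj y) ⟶
      OneCell.hom ((TwoNatTrans.app A' k).toFunctor.obj y) :=
  TwoCell.hom ((TwoMod.app Γ k).toNatTrans.app y)

theorem homMod_ext {Γ Γ' : A ⟶ A'} (e : ∀ {k : K} (y : P.obj k), homCell Γ y = homCell Γ' y) :
    Γ = Γ' :=
  TwoMod.ext (funext fun _ => Cat.Hom₂.ext (NatTrans.ext (funext fun y => TwoCell.ext (e y))))

theorem homCell_eqToHom (e : A = A') {k : K} (y : P.obj k)
    (e' : OneCell.hom ((TwoNatTrans.app A k).toFunctor.obj y) =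
      OneCell.hom ((TwoNatTrans.app A' k).toFunctor.obj y)) :
    homCell (eqToHom e) y = eqToHom e' := by
  subst e; rfl

end HomFrom

end ModuleModifications

/-! ### The lifting to modules given by a distributive law -/

section ModuleLifting

variable {K : Type u} [Bicategory.{w, v} K] [Strict K] {X₀ X : K} {I : X₀ ⟶ X}
  {S₀ : Mnd X₀} {S : Mnd X} {T : RelMonad I} {h : Compatible I S₀ S}

namespace RelDistLaw

variable (D : RelDistLaw T h)

theorem post_modMap {k k' : K} (P : k ⟶ k') :
    RightModule.post P T ⋙ D.modMap k' = D.modMap k ⋙ RightModule.post P T :=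
  CategoryTheory.Functor.ext
    (fun M => RightModule.ext_of (Strict.assoc _ _ _).symm (fun A C f => by
      simp [Strict.associator_eqToIso]))
    fun f g γ => by ext; simp [Strict.associator_eqToIso]

theorem modMap_map_postMap {k k' : K} {P P' : k ⟶ k'} (β : P ⟶ P')
    (M : RightModule T k) : (D.modMap k').map ((RightModule.postMap β T).app M) =
      eqToHom (congrArg (fun H => H.obj M) (D.post_modMap P)) ≫
        (RightModule.postMap β T).app ((D.modMap k).obj M) ≫
          eqToHom (congrArg (fun H => H.obj M) (D.post_modMap P')).symm := by
  ext; simp [Strict.associator_eqToIso]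

/-- The 2-natural transformation `(M, (-)_m) ↦ (M S₀, f ↦ (d · S f)_m)`. -/
def modTrans : modFunctor T ⟶ modFunctor T :=
  mkCatTrans (fun k => D.modMap k) (fun P => D.post_modMap P)
    (fun β f => D.modMap_map_postMap β f)

/-- The multiplication `M m₀` of `S̃`. -/
def modMul : D.modTrans ≫ D.modTrans ⟶ D.modTrans :=
  mkModMod (fun {k} (M : RightModule T k) =>
      (α_ S₀.S S₀.S M.carrier).inv ≫ S₀.mul ▷ M.carrier)
    (fun {k} (M : RightModule T k) {o} A C f => D.modMul_comm M A C f)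
    (fun {k} {M N : RightModule T k} (g : M ⟶ N) => by
      have h1 : S₀.S ◁ S₀.S ◁ RightModuleHom.hom g ≫ (α_ S₀.S S₀.S N.carrier).inv ≫
          S₀.mul ▷ N.carrier = ((α_ S₀.S S₀.S M.carrier).inv ≫ S₀.mul ▷ M.carrier) ≫
            S₀.S ◁ RightModuleHom.hom g := by
        simp [← whisker_exchange]
      exact h1)
    (fun {k k'} Q (M : RightModule T k) => by
      have h1 : (α_ S₀.S S₀.S (M.carrier ≫ Q)).inv ≫ S₀.mul ▷ (M.carrier ≫ Q) =
          eqToHom (by simp) ≫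
            ((α_ S₀.S S₀.S M.carrier).inv ≫ S₀.mul ▷ M.carrier) ▷ Q ≫
              eqToHom (Strict.assoc _ _ _) := by
        simp [Strict.associator_eqToIso]
      exact h1)

/-- The unit `M s₀` of `S̃`. -/
def modUnit : 𝟙 (modFunctor T) ⟶ D.modTrans :=
  mkModMod (fun {k} (M : RightModule T k) => (λ_ M.carrier).inv ≫ S₀.unit ▷ M.carrier)
    (fun {k} (M : RightModule T k) {o} A C f => D.modUnit_comm M A C f)
    (fun {k} {M N : RightModule T k} (g : M ⟶ N) => by
      have h1 : RightModuleHom.hom g ≫ (λ_ N.carrier).inv ≫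
          S₀.unit ▷ N.carrier = ((λ_ M.carrier).inv ≫ S₀.unit ▷ M.carrier) ≫
            S₀.S ◁ RightModuleHom.hom g := by
        simp [← whisker_exchange]
      exact h1)
    (fun {k k'} Q (M : RightModule T k) => by
      have h1 : (λ_ (M.carrier ≫ Q)).inv ≫ S₀.unit ▷ (M.carrier ≫ Q) =
          eqToHom rfl ≫ ((λ_ M.carrier).inv ≫ S₀.unit ▷ M.carrier) ▷ Q ≫
              eqToHom (Strict.assoc _ _ _) := by
        simp [Strict.associator_eqToIso, Strict.leftUnitor_eqToIso]
      exact h1)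

/-- The monad `S̃` on `Mod_T(-)`. -/
def modMnd : Mnd (modFunctor T) where
  S := D.modTrans
  mul := D.modMul
  unit := D.modUnit
  unit_left := modMod_ext fun {k} (M : RightModule T k) =>
    (congrArg TwoCell.hom (OneCell.preMul_left.{w} S₀ k ⟨M.carrier⟩) :)
  unit_right := modMod_ext fun {k} (M : RightModule T k) =>
    (congrArg TwoCell.hom (OneCell.preMul_right.{w} S₀ k ⟨M.carrier⟩) :)
  assoc := modMod_ext fun {k} (M : RightModule T k) =>
    (congrArg TwoCell.hom (OneCell.preMul_assoc.{w} S₀ k ⟨M.carrier⟩) :)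

/-- The modification `d* : U* (- ∘ S) ⟶ S̃ U*`, with components `N d`. -/
def dstar : precompTrans S.S ≫ modFree T ⟶ modFree T ≫ D.modTrans :=
  mkModMod (fun {k} (N : OneCell.{max u w} X k) =>
      (α_ T.T S.S N.hom).inv ≫ D.d ▷ N.hom ≫ (α_ S₀.S T.T N.hom).hom)
    (fun {k} (N : OneCell.{max u w} X k) {o} A C f => D.dstar_comm N.hom A C f)
    (fun {k} {M N : OneCell.{max u w} X k} (g : M ⟶ N) => by
      have h1 : T.T ◁ S.S ◁ TwoCell.hom g ≫ (α_ T.T S.S N.hom).inv ≫ D.d ▷ N.hom ≫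
          (α_ S₀.S T.T N.hom).hom =
          ((α_ T.T S.S M.hom).inv ≫ D.d ▷ M.hom ≫ (α_ S₀.S T.T M.hom).hom) ≫
            S₀.S ◁ T.T ◁ TwoCell.hom g := by
        simp only [Category.assoc]
        rw [associator_inv_naturality_right_assoc, whisker_exchange_assoc,
          associator_naturality_right]
      exact h1)
    (fun {k k'} Q (N : OneCell.{max u w} X k) => by
      have h1 : (α_ T.T S.S (N.hom ≫ Q)).inv ≫ D.d ▷ (N.hom ≫ Q) ≫
          (α_ S₀.S T.T (N.hom ≫ Q)).hom =
          eqToHom (by simp) ≫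
            ((α_ T.T S.S N.hom).inv ≫ D.d ▷ N.hom ≫ (α_ S₀.S T.T N.hom).hom) ▷ Q ≫
              eqToHom (by simp) := by
        simp [Strict.associator_eqToIso]
      exact h1)

theorem modMnd_compat : Compatible (modForget T) D.modMnd (precompMnd S₀) where
  comm := rfl
  mul := homMod_ext fun {k} (M : RightModule T k) => by
    have h1 : ((α_ S₀.S S₀.S M.carrier).inv ≫ S₀.mul ▷ M.carrier) ≫ 𝟙 _ =
        𝟙 _ ≫ S₀.S ◁ 𝟙 (S₀.S ≫ M.carrier) ≫ 𝟙 _ ≫ 𝟙 _ ≫ 𝟙 _ ≫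
          ((α_ S₀.S S₀.S M.carrier).inv ≫ S₀.mul ▷ M.carrier) := by simp
    exact h1
  unit := homMod_ext fun {k} (M : RightModule T k) => by
    have h1 : ((λ_ M.carrier).inv ≫ S₀.unit ▷ M.carrier) ≫ 𝟙 _ =
        𝟙 _ ≫ 𝟙 _ ≫ ((λ_ M.carrier).inv ≫ S₀.unit ▷ M.carrier) := by simp
    exact h1

theorem modMnd_mor : IsMndMor (precompMnd S) D.modMnd (modFree T) D.dstar where
  unit := modMod_ext fun {k} (N : OneCell.{max u w} X k) => by
    have h1 : T.T ◁ ((λ_ N.hom).inv ≫ S.unit ▷ N.hom) ≫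
        ((α_ T.T S.S N.hom).inv ≫ D.d ▷ N.hom ≫ (α_ S₀.S T.T N.hom).hom) =
        𝟙 _ ≫ 𝟙 _ ≫ ((λ_ (T.T ≫ N.hom)).inv ≫ S₀.unit ▷ (T.T ≫ N.hom)) := by
      have h2 := congrArg (· ▷ N.hom) D.unit
      simp only [comp_whiskerRight] at h2
      simp only [whiskerLeft_comp, Category.assoc]
      rw [associator_inv_naturality_middle_assoc, reassoc_of% h2]
      simp
    exact h1
  mul := modMod_ext fun {k} (N : OneCell.{max u w} X k) => by
    have h1 : T.T ◁ ((α_ S.S S.S N.hom).inv ≫ S.mul ▷ N.hom) ≫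
        ((α_ T.T S.S N.hom).inv ≫ D.d ▷ N.hom ≫ (α_ S₀.S T.T N.hom).hom) =
        𝟙 _ ≫ ((α_ T.T S.S (S.S ≫ N.hom)).inv ≫ D.d ▷ (S.S ≫ N.hom) ≫
          (α_ S₀.S T.T (S.S ≫ N.hom)).hom) ≫ 𝟙 _ ≫
          S₀.S ◁ ((α_ T.T S.S N.hom).inv ≫ D.d ▷ N.hom ≫ (α_ S₀.S T.T N.hom).hom) ≫ 𝟙 _ ≫
          ((α_ S₀.S S₀.S (T.T ≫ N.hom)).inv ≫ S₀.mul ▷ (T.T ≫ N.hom)) := by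
      have h2 := congrArg (· ▷ N.hom) D.mul
      simp only [comp_whiskerRight] at h2
      simp only [whiskerLeft_comp, Category.assoc, Category.id_comp]
      rw [associator_inv_naturality_middle_assoc, reassoc_of% h2]
      bicategory
    exact h1

/-- The lifting of `S` to the relative right modules of `T`. -/
def modLifting : ModLifting T h where
  monad := D.modMnd
  dstar := D.dstar
  compat := D.modMnd_compat
  mor := D.modMnd_mor
  unit := homMod_ext fun {k} (N : OneCell.{max u w} X k) => by
    have h1 : T.unit ▷ (S.S ≫ N.hom) ≫ 𝟙 _ ≫ ((α_ T.T S.S N.hom).inv ≫ D.d ▷ N.hom ≫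
        (α_ S₀.S T.T N.hom).hom) ≫ 𝟙 _ ≫ 𝟙 _ ≫ 𝟙 _ =
        eqToHom (by rw [← Strict.assoc, h.comm, Strict.assoc]) ≫ S₀.S ◁ T.unit ▷ N.hom := by
      have h2 := congrArg (· ▷ N.hom) D.relUnit
      simp only [comp_whiskerRight] at h2
      simp only [Category.id_comp, Category.comp_id]
      rw [associator_inv_naturality_left_assoc, reassoc_of% h2]
      simp [Strict.associator_eqToIso]
    exact h1.trans (congrArg (· ≫ _) (homCell_eqToHom (precompTrans_comm h.comm) N _).symm)
  action M _ A C f := by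
    have h1 : (α_ A S₀.S M.carrier).inv ≫
        M.op.app (A ≫ S₀.S) (C ≫ S₀.S) (distExt T h D.d A C f) ≫ (α_ C S₀.S M.carrier).hom =
        eqToHom (by rw [Strict.assoc]) ≫ M.op.app (A ≫ S₀.S) (C ≫ S₀.S)
          ((A ≫ S₀.S) ◁ T.unit ≫ eqToHom (by rw [Strict.assoc]) ≫
            ((α_ A S₀.S T.T).inv ≫ T.ext.app (A ≫ S₀.S) (C ≫ S₀.S) (distExt T h D.d A C f) ≫
              (α_ C S₀.S T.T).hom) ≫ eqToHom (by rw [Strict.assoc])) ≫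
          eqToHom (by rw [Strict.assoc]) := by
      have h2 : (A ≫ S₀.S) ◁ T.unit ≫ T.ext.app (A ≫ S₀.S) (C ≫ S₀.S) (distExt T h D.d A C f) =
          distExt T h D.d A C f := T.unit_left _ _ _
      simp only [Strict.associator_eqToIso, eqToIso.hom, eqToIso.inv, Category.assoc,
        eqToHom_trans, eqToHom_trans_assoc, eqToHom_refl, Category.comp_id, Category.id_comp, h2]
    exact h1

end RelDistLaw

end ModuleLifting

/-! ### The distributive law of a lifting to modules -/

section ModuleFunctorExt

variable {K : Type u} [Bicategory.{w, v} K] {X₀ X : K} {I : X₀ ⟶ X} {T : RelMonad I}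

theorem RightModule.functor_ext {C : Type u₁} [Category.{v₁} C] {k : K}
    {F G : C ⥤ RightModule T k} (obj : ∀ x, F.obj x = G.obj x)
    (map : ∀ {x y : C} (g : x ⟶ y), RightModuleHom.hom (F.map g) = eqToHom (by rw [obj]) ≫
      RightModuleHom.hom (G.map g) ≫ eqToHom (by rw [obj])) : F = G :=
  CategoryTheory.Functor.ext obj fun x y g => by ext; simp [map]

end ModuleFunctorExt

section ModuleLiftingStructure

variable {K : Type u} [Bicategory.{w, v} K] [Strict K] {X₀ X : K} {I : X₀ ⟶ X}
  {S₀ : Mnd X₀} {S : Mnd X} {T : RelMonad I} {h : Compatible I S₀ S}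

theorem modCell_congr {P : StrictPseudofunctor K Cat.{w, max u v w}} {A A' : P ⟶ modFunctor T}
    (Γ : A ⟶ A') {k : K} {x y : P.obj k} (e : x = y) :
    modCell Γ x = eqToHom (by rw [e]) ≫ modCell Γ y ≫ eqToHom (by rw [e]) := by
  subst e; simp

theorem eqToHom_conj_trans {C : Type u₁} [Category.{v₁} C] {x y x' y' x'' y'' : C} {f : x ⟶ y}
    {g : x' ⟶ y'} {l : x'' ⟶ y''} {p q p' q'} (hf : f = eqToHom p ≫ g ≫ eqToHom q)
    (hg : g = eqToHom p' ≫ l ≫ eqToHom q') :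
    f = eqToHom (p.trans p') ≫ l ≫ eqToHom (q'.trans q) := by
  rw [hf, hg]; simp

namespace ModLifting

variable (L : ModLifting T h)

theorem carrier_eq {k : K} (M : RightModule T k) :
    (modAt L.monad.S M).carrier = S₀.S ≫ M.carrier :=
  modAt_carrier L.compat.comm M

/-- The operator of `S̃(M, (-)_m)`, on the 1-cell `M S₀`. -/
def op {k : K} (M : RightModule T k) {o : K} (A C : o ⟶ X₀) (f : A ≫ I ⟶ C ≫ T.T) :
    A ≫ S₀.S ≫ M.carrier ⟶ C ≫ S₀.S ≫ M.carrier :=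
  A ◁ eqToHom (L.carrier_eq M).symm ≫ (modAt L.monad.S M).op.app A C f ≫
    C ◁ eqToHom (L.carrier_eq M)

theorem op_congr {k : K} {M M' : RightModule T k} (e : M = M') {o : K} (A C : o ⟶ X₀)
    (f : A ≫ I ⟶ C ≫ T.T) :
    L.op M A C f = eqToHom (by rw [e]) ≫ L.op M' A C f ≫ eqToHom (by rw [e]) := by
  subst e; simp

/-- The 2-cell `S T N ⟶ T S₀ N` underlying `d*_N`. -/
def cell {k : K} (N : X ⟶ k) : T.T ≫ S.S ≫ N ⟶ S₀.S ≫ T.T ≫ N :=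
  modCell L.dstar (OneCell.mk N) ≫
    eqToHom (L.carrier_eq (RightModule.postObj N (RightModule.self T)))

/-- The 2-cell `S T ⟶ T S₀` underlying `d*` at the identity. -/
def dist : T.T ≫ S.S ⟶ S₀.S ≫ T.T :=
  T.T ◁ (ρ_ S.S).inv ≫ L.cell (𝟙 X) ≫ S₀.S ◁ (ρ_ T.T).hom

/-- On morphisms, a lifting is whiskering with `S₀`, up to the identification of carriers. -/
theorem mapCell {k : K} {M N : RightModule T k} (g : M ⟶ N) :
    modMapCell L.monad.S (k := k) (x := M) (y := N) g =
      eqToHom (L.carrier_eq M) ≫ S₀.S ◁ RightModuleHom.hom g ≫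
        eqToHom (L.carrier_eq N).symm := by
  have h1 := congrArg
    (fun F : modFunctor T ⟶ homFrom.{max u w} X₀ => (TwoNatTrans.app F k).toFunctor)
    L.compat.comm
  exact OneCell.functor_congr_hom (C := RightModule T k) h1.symm g

/-- By modification naturality, `d*_N` is `N d`. -/
theorem cell_eq {k : K} (N : X ⟶ k) :
    L.cell N = (α_ T.T S.S N).inv ≫ L.dist ▷ N ≫ (α_ S₀.S T.T N).hom := by
  have h1 := modCell_post L.dstar N (OneCell.mk (𝟙 X))
  have h2 := modCell_congr L.dstar (x := OneCell.mk N) (y := OneCell.mk (𝟙 X ≫ N))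
    (by rw [Strict.id_comp])
  have aux : ∀ {Y : X₀ ⟶ X} {Y' : X₀ ⟶ k} (c : T.T ≫ S.S ≫ 𝟙 X ⟶ Y) (c' : T.T ≫ S.S ≫ N ⟶ Y')
      (p : Y = S₀.S ≫ T.T ≫ 𝟙 X) (p' : Y' = S₀.S ≫ T.T ≫ N) (q : _) (q' : _)
      (_ : c' = eqToHom q ≫ c ▷ N ≫ eqToHom q'), c' ≫ eqToHom p' = (α_ T.T S.S N).inv ≫
        (T.T ◁ (ρ_ S.S).inv ≫ (c ≫ eqToHom p) ≫ S₀.S ◁ (ρ_ T.T).hom) ▷ N ≫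
          (α_ S₀.S T.T N).hom := by
    intro Y Y' c c' p p' q q' e
    subst p p' e
    simp [Strict.associator_eqToIso, Strict.rightUnitor_eqToIso]
  exact aux (modCell L.dstar (OneCell.mk (𝟙 X))) (modCell L.dstar (OneCell.mk N)) _ _ _ _
    (eqToHom_conj_trans h2 h1)

/-- `d*` being a morphism of modules at the identity. -/
theorem dist_comm {o : K} (A C : o ⟶ X₀) (f : A ≫ I ⟶ C ≫ T.T) :
    T.ext.app A C f ▷ S.S ≫ (α_ C T.T S.S).hom ≫ C ◁ L.dist =
      (α_ A T.T S.S).hom ≫ A ◁ L.dist ≫ L.op (RightModule.self T) A C f := by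
  have h1 : ((α_ A T.T (S.S ≫ 𝟙 X)).inv ≫ T.ext.app A C f ▷ (S.S ≫ 𝟙 X) ≫
      (α_ C T.T (S.S ≫ 𝟙 X)).hom) ≫ C ◁ modCell L.dstar (OneCell.mk (𝟙 X)) =
      A ◁ modCell L.dstar (OneCell.mk (𝟙 X)) ≫
        (modAt L.monad.S (RightModule.postObj (𝟙 X) (RightModule.self T))).op.app A C f :=
    RightModuleHom.comm ((TwoMod.app L.dstar X).toNatTrans.app (OneCell.mk (𝟙 X))) A C f
  have aux : ∀ {Y : X₀ ⟶ X} (c : T.T ≫ S.S ≫ 𝟙 X ⟶ Y) (w : A ≫ Y ⟶ C ≫ Y)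
      (p : Y = S₀.S ≫ T.T ≫ 𝟙 X) (z : A ≫ T.T ⟶ C ≫ T.T)
      (_ : ((α_ A T.T (S.S ≫ 𝟙 X)).inv ≫ z ▷ (S.S ≫ 𝟙 X) ≫ (α_ C T.T (S.S ≫ 𝟙 X)).hom) ≫
        C ◁ c = A ◁ c ≫ w),
      z ▷ S.S ≫ (α_ C T.T S.S).hom ≫
          C ◁ (T.T ◁ (ρ_ S.S).inv ≫ (c ≫ eqToHom p) ≫ S₀.S ◁ (ρ_ T.T).hom) =
        (α_ A T.T S.S).hom ≫
          A ◁ (T.T ◁ (ρ_ S.S).inv ≫ (c ≫ eqToHom p) ≫ S₀.S ◁ (ρ_ T.T).hom) ≫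
          A ◁ S₀.S ◁ (ρ_ T.T).inv ≫ (A ◁ eqToHom p.symm ≫ w ≫ C ◁ eqToHom p) ≫
            C ◁ S₀.S ◁ (ρ_ T.T).hom := by
    intro Y c w p z e
    subst p
    have e1 : z ▷ S.S ≫ (α_ C T.T S.S).hom ≫ C ◁ T.T ◁ (ρ_ S.S).inv =
        (α_ A T.T S.S).hom ≫ A ◁ T.T ◁ (ρ_ S.S).inv ≫ (α_ A T.T (S.S ≫ 𝟙 X)).inv ≫
          z ▷ (S.S ≫ 𝟙 X) ≫ (α_ C T.T (S.S ≫ 𝟙 X)).hom := by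
      bicategory
    simp only [Category.assoc] at e
    simp only [whiskerLeft_comp, Category.assoc, eqToHom_refl, whiskerLeft_id, Category.id_comp]
    rw [reassoc_of% e1, reassoc_of% e]
    simp
  have h2 : RightModule.self T = RightModule.postObj (𝟙 X) (RightModule.self T) :=
    (congrArg (fun H => H.obj (RightModule.self T)) (RightModule.post_id X T)).symm
  have h3 : L.op (RightModule.self T) A C f = A ◁ S₀.S ◁ (ρ_ T.T).inv ≫
      L.op (RightModule.postObj (𝟙 X) (RightModule.self T)) A C f ≫ C ◁ S₀.S ◁ (ρ_ T.T).hom := by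
    rw [L.op_congr h2]
    simp [Strict.rightUnitor_eqToIso]
  rw [h3]
  exact aux _ _ (L.carrier_eq _) _ h1

/-- The unit condition on `d*`. -/
theorem dist_relUnit : T.unit ▷ S.S ≫ L.dist = eqToHom h.comm ≫ S₀.S ◁ T.unit := by
  have h1 : T.unit ▷ (S.S ≫ 𝟙 X) ≫ 𝟙 _ ≫ modCell L.dstar (OneCell.mk (𝟙 X)) ≫ 𝟙 _ ≫
      homCell (eqToHom L.compat.comm.symm) (RightModule.postObj (𝟙 X) (RightModule.self T)) ≫
        𝟙 _ =
      homCell (P := homFrom.{max u w} X) (eqToHom (precompTrans_comm h.comm))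
        (OneCell.mk (𝟙 X)) ≫ S₀.S ◁ T.unit ▷ 𝟙 X :=
    congrArg (fun Γ => homCell Γ (k := X) (OneCell.mk (𝟙 X))) L.unit
  have e1 : homCell (eqToHom L.compat.comm.symm)
      (RightModule.postObj (𝟙 X) (RightModule.self T)) = eqToHom (L.carrier_eq _) :=
    homCell_eqToHom _ _ _
  have q : I ≫ S.S ≫ 𝟙 X = S₀.S ≫ I ≫ 𝟙 X := by rw [← Strict.assoc, h.comm, Strict.assoc]
  have e2 : homCell (P := homFrom.{max u w} X) (eqToHom (precompTrans_comm h.comm))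
      (OneCell.mk (𝟙 X)) = eqToHom q := homCell_eqToHom _ _ _
  rw [e1, e2] at h1
  have aux : ∀ {Y : X₀ ⟶ X} (c : T.T ≫ S.S ≫ 𝟙 X ⟶ Y) (p : Y = S₀.S ≫ T.T ≫ 𝟙 X)
      (_ : T.unit ▷ (S.S ≫ 𝟙 X) ≫ 𝟙 _ ≫ c ≫ 𝟙 _ ≫ eqToHom p ≫ 𝟙 _ =
        eqToHom q ≫ S₀.S ◁ T.unit ▷ 𝟙 X),
      T.unit ▷ S.S ≫ T.T ◁ (ρ_ S.S).inv ≫ (c ≫ eqToHom p) ≫ S₀.S ◁ (ρ_ T.T).hom =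
        eqToHom h.comm ≫ S₀.S ◁ T.unit := by
    intro Y c p e
    subst p
    simp only [eqToHom_refl, Category.id_comp, Category.comp_id] at e ⊢
    rw [← whisker_exchange_assoc, reassoc_of% e]
    simp [Strict.rightUnitor_eqToIso]
  exact aux _ _ h1

/-- The 2-cell `f_{S̃T} · t S₀ A` of the action condition is `d C · S f`: `t S₀` is `d · S t` by the
unit condition, and `d` is a module morphism, so that `f_{S̃T} · d · S t` is `d · S (f^† · t)`. -/
theorem distExt_eq {o : K} (A C : o ⟶ X₀) (f : A ≫ I ⟶ C ≫ T.T) :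
    (A ≫ S₀.S) ◁ T.unit ≫ (α_ A S₀.S T.T).hom ≫ L.op (RightModule.self T) A C f ≫
      (α_ C S₀.S T.T).inv = distExt T h L.dist A C f := by
  have h1 := L.dist_comm A C f
  have h2 := congrArg (A ◁ ·) L.dist_relUnit
  have h3 := congrArg (· ▷ S.S) (T.unit_left A C f)
  simp only [whiskerLeft_comp] at h2
  simp only [comp_whiskerRight] at h3
  have h4 : A ◁ S₀.S ◁ T.unit = A ◁ eqToHom h.comm.symm ≫ A ◁ T.unit ▷ S.S ≫ A ◁ L.dist := by
    rw [h2, ← whiskerLeft_comp_assoc, eqToHom_trans, eqToHom_refl, whiskerLeft_id,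
      Category.id_comp]
  rw [← Iso.inv_comp_eq] at h1
  simp only [distExt, comp_whiskerLeft, Category.assoc, Iso.inv_hom_id_assoc, h4]
  rw [← reassoc_of% h1, associator_inv_naturality_middle_assoc, reassoc_of% h3]

/-- The action condition determines the operator of `S̃(M, (-)_m)` by the 2-cell `S T ⟶ T S₀`. -/
theorem op_eq {k : K} (M : RightModule T k) {o : K} (A C : o ⟶ X₀) (f : A ≫ I ⟶ C ≫ T.T) :
    L.op M A C f = (α_ A S₀.S M.carrier).inv ≫
      M.op.app (A ≫ S₀.S) (C ≫ S₀.S) (distExt T h L.dist A C f) ≫ (α_ C S₀.S M.carrier).hom := by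
  rw [← distExt_eq, op, L.action M A C f]
  simp [op, Strict.associator_eqToIso]

/-- The multiplication of `S̃` lies over that of `- ∘ S₀`. -/
theorem mul_cell {k : K} (M : RightModule T k) :
    modCell L.monad.mul M = eqToHom ((L.carrier_eq _).trans (by rw [L.carrier_eq])) ≫
      ((α_ S₀.S S₀.S M.carrier).inv ≫ S₀.mul ▷ M.carrier) ≫
        eqToHom (L.carrier_eq M).symm := by
  have h1 : ((α_ S₀.S S₀.S M.carrier).inv ≫ S₀.mul ▷ M.carrier) ≫
      homCell (eqToHom L.compat.comm) M =
      𝟙 _ ≫ S₀.S ◁ homCell (eqToHom L.compat.comm) M ≫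
      𝟙 _ ≫ homCell (eqToHom L.compat.comm) (modAt L.monad.S M) ≫ 𝟙 _ ≫ modCell L.monad.mul M :=
    congrArg (fun Γ => homCell Γ (k := k) M)
      L.compat.mul
  have e1 : ∀ N : RightModule T k, homCell (eqToHom L.compat.comm) N =
      eqToHom (L.carrier_eq N).symm := fun N => homCell_eqToHom _ _ _
  rw [e1, e1] at h1
  have aux : ∀ {Y Z W : X₀ ⟶ k} (c : W ⟶ Y) (p : Y = S₀.S ≫ M.carrier) (q : Z = S₀.S ≫ Y)
      (r : Z = W) (d : S₀.S ≫ S₀.S ≫ M.carrier ⟶ S₀.S ≫ M.carrier)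
      (_ : d ≫ eqToHom p.symm = 𝟙 _ ≫ S₀.S ◁ eqToHom p.symm ≫ 𝟙 _ ≫ eqToHom q.symm ≫
        eqToHom r ≫ c), c = eqToHom (r.symm.trans (q.trans (by rw [p]))) ≫ d ≫ eqToHom p.symm := by
    intro Y Z W c p q r d e
    subst p q r
    simpa using e.symm
  exact aux _ (L.carrier_eq M) (L.carrier_eq (modAt L.monad.S M)) rfl _ h1

/-- The unit of `S̃` lies over that of `- ∘ S₀`. -/
theorem unit_cell {k : K} (M : RightModule T k) :
    modCell L.monad.unit M = ((λ_ M.carrier).inv ≫ S₀.unit ▷ M.carrier) ≫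
      eqToHom (L.carrier_eq M).symm := by
  have h1 : ((λ_ M.carrier).inv ≫ S₀.unit ▷ M.carrier) ≫
      homCell (eqToHom L.compat.comm) M =
      𝟙 _ ≫ 𝟙 _ ≫ modCell L.monad.unit M :=
    congrArg (fun Γ => homCell Γ (k := k) M)
      L.compat.unit
  have e1 : homCell (eqToHom L.compat.comm) M = eqToHom (L.carrier_eq M).symm :=
    homCell_eqToHom _ _ _
  rw [e1] at h1
  refine ((Category.id_comp _).symm.trans ((Category.id_comp _).symm.trans ?_))
  exact h1.symm

theorem dist_unit : T.T ◁ S.unit ≫ L.dist = (ρ_ T.T).hom ≫ (λ_ T.T).inv ≫ S₀.unit ▷ T.T := by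
  have h1 : T.T ◁ ((λ_ (𝟙 X)).inv ≫ S.unit ▷ 𝟙 X) ≫ modCell L.dstar (OneCell.mk (𝟙 X)) =
      𝟙 _ ≫ 𝟙 _ ≫ modCell L.monad.unit (RightModule.postObj (𝟙 X) (RightModule.self T)) :=
    congrArg (fun Γ => modCell Γ (k := X) (OneCell.mk (𝟙 X))) L.mor.unit
  rw [unit_cell] at h1
  have h2 : T.T ◁ ((λ_ (𝟙 X)).inv ≫ S.unit ▷ 𝟙 X) ≫ L.cell (𝟙 X) =
      (λ_ (T.T ≫ 𝟙 X)).inv ≫ S₀.unit ▷ (T.T ≫ 𝟙 X) := by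
    have aux : ∀ {V W Y Z : X₀ ⟶ X} (x : V ⟶ W) (c : W ⟶ Y) (p : Y = Z) (y : V ⟶ Z)
        (_ : x ≫ c = 𝟙 _ ≫ 𝟙 _ ≫ y ≫ eqToHom p.symm), x ≫ c ≫ eqToHom p = y := by
      intro V W Y Z x c p y e
      subst p
      simpa using e
    exact aux _ _ (L.carrier_eq _) _ h1
  rw [cell_eq, whiskerLeft_comp, Category.assoc, associator_inv_naturality_middle_assoc,
    ← comp_whiskerRight_assoc] at h2
  rw [← whiskerRight_iff]
  have h3 := congrArg (fun z => (α_ T.T (𝟙 X) (𝟙 X)).hom ≫ T.T ◁ (λ_ (𝟙 X)).hom ≫ z ≫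
    (α_ S₀.S T.T (𝟙 X)).inv) h2
  simp only [Category.assoc, Iso.hom_inv_id, Category.comp_id, whiskerLeft_hom_inv_assoc,
    Iso.hom_inv_id_assoc] at h3
  rw [h3]
  bicategory

theorem dist_mul : T.T ◁ S.mul ≫ L.dist = (α_ T.T S.S S.S).inv ≫ L.dist ▷ S.S ≫
    (α_ S₀.S T.T S.S).hom ≫ S₀.S ◁ L.dist ≫ (α_ S₀.S S₀.S T.T).inv ≫ S₀.mul ▷ T.T := by
  have h1 : T.T ◁ ((α_ S.S S.S (𝟙 X)).inv ≫ S.mul ▷ 𝟙 X) ≫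
      modCell L.dstar (OneCell.mk (𝟙 X)) =
      𝟙 _ ≫ modCell L.dstar (OneCell.mk (S.S ≫ 𝟙 X)) ≫ 𝟙 _ ≫
      modMapCell L.monad.S (k := X)
        (x := RightModule.postObj (S.S ≫ 𝟙 X) (RightModule.self T))
        (y := modAt L.monad.S (RightModule.postObj (𝟙 X) (RightModule.self T)))
        ((TwoMod.app L.dstar X).toNatTrans.app (OneCell.mk (𝟙 X))) ≫ 𝟙 _ ≫
      modCell L.monad.mul (RightModule.postObj (𝟙 X) (RightModule.self T)) :=
    congrArg (fun Γ => modCell Γ (k := X) (OneCell.mk (𝟙 X))) L.mor.mul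
  have e1 : modMapCell L.monad.S (k := X)
        (x := RightModule.postObj (S.S ≫ 𝟙 X) (RightModule.self T))
        (y := modAt L.monad.S (RightModule.postObj (𝟙 X) (RightModule.self T)))
        ((TwoMod.app L.dstar X).toNatTrans.app (OneCell.mk (𝟙 X))) =
      eqToHom (L.carrier_eq _) ≫ S₀.S ◁ modCell L.dstar (OneCell.mk (𝟙 X)) ≫
        eqToHom (L.carrier_eq _).symm :=
    L.mapCell (M := RightModule.postObj (S.S ≫ 𝟙 X) (RightModule.self T))
      (N := modAt L.monad.S (RightModule.postObj (𝟙 X) (RightModule.self T))) _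
  rw [mul_cell] at h1
  replace h1 := h1.trans (congrArg (fun z => 𝟙 _ ≫ modCell L.dstar (OneCell.mk (S.S ≫ 𝟙 X)) ≫
    𝟙 _ ≫ z ≫ 𝟙 _ ≫ _) e1)
  have h2 : T.T ◁ ((α_ S.S S.S (𝟙 X)).inv ≫ S.mul ▷ 𝟙 X) ≫ L.cell (𝟙 X) =
      L.cell (S.S ≫ 𝟙 X) ≫ S₀.S ◁ L.cell (𝟙 X) ≫ (α_ S₀.S S₀.S (T.T ≫ 𝟙 X)).inv ≫
        S₀.mul ▷ (T.T ≫ 𝟙 X) := by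
    have aux : ∀ {V W Y Y' Z U G R Q : X₀ ⟶ X} (x : V ⟶ W) (c : W ⟶ Y) (p : Y = Z)
        (y : V ⟶ Y') (p' : Y' = S₀.S ≫ U) (g : U ⟶ G) (e : G = R) (r : Q = S₀.S ≫ G)
        (q' : Q = S₀.S ≫ R) (z : S₀.S ≫ R ⟶ Z)
        (_ : x ≫ c = 𝟙 _ ≫ y ≫ 𝟙 _ ≫ (eqToHom p' ≫ S₀.S ◁ g ≫ eqToHom r.symm) ≫ 𝟙 _ ≫
          eqToHom q' ≫ z ≫ eqToHom p.symm),
        x ≫ c ≫ eqToHom p = (y ≫ eqToHom p') ≫ S₀.S ◁ (g ≫ eqToHom e) ≫ z := by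
      intro V W Y Y' Z U G R Q x c p y p' g e r q' z hx
      subst p p' e r
      simpa using hx
    exact (aux _ _ (L.carrier_eq _) _ (L.carrier_eq _) _ (L.carrier_eq _) (L.carrier_eq _)
      _ _ h1).trans rfl
  rw [cell_eq, cell_eq] at h2
  rw [← whiskerRight_iff]
  have h3 := congrArg (fun z => (α_ T.T (S.S ≫ S.S) (𝟙 X)).hom ≫ T.T ◁ (α_ S.S S.S (𝟙 X)).hom ≫
    z ≫ (α_ S₀.S T.T (𝟙 X)).inv) h2
  refine Eq.trans ?_ (h3.trans ?_)
  · bicategory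
  · bicategory

/-- The relative distributive law of a lifting to modules. -/
def distLaw : RelDistLaw T h where
  d := L.dist
  mul := L.dist_mul
  unit := L.dist_unit
  relUnit := L.dist_relUnit
  extension A C f := by
    have h1 := L.dist_comm A C f
    rw [L.op_eq] at h1
    rw [reassoc_of% h1]
    simp

/-- Given the 2-cell `S T ⟶ T S₀`, the underlying 2-cells of the multiplication, of the unit and of
`d*` are prescribed, so that only the underlying 2-natural transformation is left to compare. -/
theorem ext_monad {L L' : ModLifting T h} (hS : L.monad.S = L'.monad.S)
    (hL : L.dist = L'.dist) : L = L' := by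
  -- Recorded before `L` and `L'` are taken apart, since these lemmas concern whole liftings.
  have hm : ∀ {k : K} (M : RightModule T k), _ := fun M => L.mul_cell M
  have hm' : ∀ {k : K} (M : RightModule T k), _ := fun M => L'.mul_cell M
  have hu : ∀ {k : K} (M : RightModule T k), _ := fun M => L.unit_cell M
  have hu' : ∀ {k : K} (M : RightModule T k), _ := fun M => L'.unit_cell M
  have hd : ∀ {k : K} (N : X ⟶ k), L.cell N = L'.cell N := fun N => by
    rw [cell_eq, cell_eq, hL]
  have aux : ∀ {k : K} {V Y Z : X₀ ⟶ k} (c c' : V ⟶ Y) (p : Y = Z)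
      (_ : c ≫ eqToHom p = c' ≫ eqToHom p), c = c' := by
    rintro k V Y _ c c' rfl e
    simpa using e
  obtain ⟨⟨U, m, u, _, _, _⟩, ds, c, _, _, _⟩ := L
  obtain ⟨⟨U', m', u', _, _, _⟩, ds', c', _, _, _⟩ := L'
  obtain rfl : U = U' := hS
  obtain rfl : m = m' := modMod_ext fun M => (hm M).trans (hm' M).symm
  obtain rfl : u = u' := modMod_ext fun M => (hu M).trans (hu' M).symm
  obtain rfl : ds = ds' := modMod_ext fun {k} (N : OneCell.{max u w} X k) =>
    aux _ _ _ (hd N.hom)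
  rfl

/-- A lifting is determined by the component of `d*` at the identity. -/
theorem ext_dist {L L' : ModLifting T h} (hL : L.dist = L'.dist) : L = L' := by
  refine ext_monad (TwoNatTrans.ext (funext fun k => Cat.ext ?_)) hL
  refine RightModule.functor_ext (C := RightModule T k) (fun M => ?_) (fun {M N} g => ?_)
  · refine RightModule.ext_of ((L.carrier_eq M).trans (L'.carrier_eq M).symm) ?_
    intro o A C f
    have h1 := L.op_eq M A C f
    rw [hL, ← L'.op_eq, op, op, whiskerLeft_eqToHom, whiskerLeft_eqToHom, eqToHom_comp_iff,
      comp_eqToHom_iff] at h1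
    refine h1.trans ?_
    simp
  · refine (L.mapCell (M := M) (N := N) g).trans ?_
    have h1 := L'.mapCell (M := M) (N := N) g
    have h2 : eqToHom (L.carrier_eq M) ≫ S₀.S ◁ RightModuleHom.hom g ≫
        eqToHom (L.carrier_eq N).symm =
        eqToHom ((L.carrier_eq M).trans (L'.carrier_eq M).symm) ≫
          modMapCell L'.monad.S (k := k) (x := M) (y := N) g ≫
          eqToHom ((L'.carrier_eq N).trans (L.carrier_eq N).symm) := by
      rw [h1]; simp
    exact h2

end ModLifting

/-- Relative distributive laws are equivalent to liftings to the relative right modules. -/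
def modEquiv (T : RelMonad I) (h : Compatible I S₀ S) : RelDistLaw T h ≃ ModLifting T h where
  toFun D := D.modLifting
  invFun L := L.distLaw
  left_inv D := by
    refine RelDistLaw.ext_d ?_
    have h1 : T.T ◁ (ρ_ S.S).inv ≫ (((α_ T.T S.S (𝟙 X)).inv ≫ D.d ▷ 𝟙 X ≫
        (α_ S₀.S T.T (𝟙 X)).hom) ≫ 𝟙 _) ≫ S₀.S ◁ (ρ_ T.T).hom = D.d := by
      simp
    exact h1
  right_inv L := ModLifting.ext_dist (by
    have h1 : T.T ◁ (ρ_ S.S).inv ≫ (((α_ T.T S.S (𝟙 X)).inv ≫ L.dist ▷ 𝟙 X ≫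
        (α_ S₀.S T.T (𝟙 X)).hom) ≫ 𝟙 _) ≫ S₀.S ◁ (ρ_ T.T).hom = L.dist := by
      simp
    exact h1)

end ModuleLiftingStructure

end RelBeck

/-! ### The two bijections -/

theorem mainTheorem1 {K : Type u} [Bicategory.{w, v} K] [Bicategory.Strict K] {X₀ X : K}
    {I : X₀ ⟶ X} (T : RelBeck.RelMonad I) (S₀ : RelBeck.Mnd X₀) (S : RelBeck.Mnd X)
    (h : RelBeck.Compatible I S₀ S) :
    (∃ e : RelBeck.RelDistLaw T h ≃ RelBeck.AlgLifting T h,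
      (∀ (D : RelBeck.RelDistLaw T h) (k : K) (M : RelBeck.Alg S₀ k),
        (RelBeck.algAt (e D).monad.T M).str =
          eqToHom (by rw [RelBeck.algAt_carrier (e D).forget_comm]) ≫
            (α_ M.carrier T.T S.S).hom ≫ M.carrier ◁ D.d ≫ (α_ M.carrier S₀.S T.T).inv ≫
            M.str ▷ T.T ≫ eqToHom (RelBeck.algAt_carrier (e D).forget_comm M).symm) ∧
      (∀ L : RelBeck.AlgLifting T h,
        (e.symm L).d =
          ((λ_ T.T).inv ≫ S₀.unit ▷ T.T) ▷ S.S ≫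
            eqToHom (by rw [RelBeck.algAt_carrier L.forget_comm]; rfl) ≫
            (RelBeck.algAt L.monad.T (RelBeck.freeAlg S₀)).str ≫
            eqToHom (RelBeck.algAt_carrier L.forget_comm (RelBeck.freeAlg S₀)))) ∧
    (∃ e : RelBeck.RelDistLaw T h ≃ RelBeck.ModLifting T h,
      (∀ D : RelBeck.RelDistLaw T h,
        (∀ (k : K) (M : RelBeck.RightModule T k) (o : K) (A C : o ⟶ X₀)
          (f : A ≫ I ⟶ C ≫ T.T),
          (RelBeck.modAt (e D).monad.S M).op.app A C f =
            eqToHom (by rw [RelBeck.modAt_carrier (e D).compat.comm, Bicategory.Strict.assoc]) ≫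
              M.op.app (A ≫ S₀.S) (C ≫ S₀.S) (RelBeck.distExt T h D.d A C f) ≫
              eqToHom (by rw [RelBeck.modAt_carrier (e D).compat.comm,
                Bicategory.Strict.assoc])) ∧
        (∀ (k : K) (N : X ⟶ k),
          RelBeck.modCell (e D).dstar (RelBeck.OneCell.mk N) =
            (α_ T.T S.S N).inv ≫ D.d ▷ N ≫ (α_ S₀.S T.T N).hom ≫
              eqToHom (RelBeck.modAt_carrier (e D).compat.comm
                ((RelBeck.RightModule.self T).postObj N)).symm)) ∧
      (∀ L : RelBeck.ModLifting T h,
        (e.symm L).d =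
          T.T ◁ (ρ_ S.S).inv ≫ RelBeck.modCell L.dstar (RelBeck.OneCell.mk (𝟙 X)) ≫
            eqToHom (RelBeck.modAt_carrier L.compat.comm
              ((RelBeck.RightModule.self T).postObj (𝟙 X))) ≫ S₀.S ◁ (ρ_ T.T).hom)) := by
  refine ⟨⟨RelBeck.algEquiv T h, fun D k M => ?_, fun L => rfl⟩,
    ⟨RelBeck.modEquiv T h, fun D => ⟨fun k M o A C f => ?_, fun k N => ?_⟩,
      fun L => congrArg (_ ≫ ·) (Category.assoc _ _ _)⟩⟩
  -- The lifting given by `D` has the prescribed carriers by definition, so that each `eqToHom` of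
  -- the claim is an identity or a coherence isomorphism.
  · have h1 : RelBeck.Alg.inducedStr D.d M = 𝟙 _ ≫ (α_ M.carrier T.T S.S).hom ≫
        M.carrier ◁ D.d ≫ (α_ M.carrier S₀.S T.T).inv ≫ M.str ▷ T.T ≫ 𝟙 _ := by
      simp
    exact h1
  · have h1 : (α_ A S₀.S M.carrier).inv ≫ M.op.app (A ≫ S₀.S) (C ≫ S₀.S)
          (RelBeck.distExt T h D.d A C f) ≫ (α_ C S₀.S M.carrier).hom =
        eqToHom (by rw [Strict.assoc]) ≫ M.op.app (A ≫ S₀.S) (C ≫ S₀.S)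
          (RelBeck.distExt T h D.d A C f) ≫ eqToHom (by rw [Strict.assoc]) := by
      simp [Strict.associator_eqToIso]
    exact h1
  · have h1 : (α_ T.T S.S N).inv ≫ D.d ▷ N ≫ (α_ S₀.S T.T N).hom =
        (α_ T.T S.S N).inv ≫ D.d ▷ N ≫ (α_ S₀.S T.T N).hom ≫ 𝟙 _ := by
      simp
    exact h1
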